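/- Let $\Gamma$ be a locally compact, $\sigma$-compact (Hausdorff) topological group with a left Haar measure $\mu$, and let $K\subset\Gamma$ be a compact subset that contains a neighbourhood of the identity and generates $\Gamma$ in the sense that $\Gamma=\bigcup_{n} K^n$, where $K^n$ is the set of products of $n$ elements of $K$. Suppose that $\Gamma$ has property $(T)$: every continuous isometric action of $\Gamma$ on a Hilbert space has a fixed point. Let $\mathcal U_2(\Gamma)$ be the set of continuous functions $f:\Gamma\to[0,\infty)$ with compact support such that $\int_\Gamma f\,d\mu=1$ and $f>0$ on $K^2$. Let $f^{*m}$ be the $m$-fold convolution of $f$ with itself, where $(f*g)(\gamma)=\int_\Gamma f(t)g(t^{-1}\gamma)\,d\mu(t)$. Let $X$ be a metric space, $x\in X$, let $B(x,r)$ be the open ball of radius $r$ around $x$, let $s\ge 1$ be an integer, and let $r,\varepsilon,\delta>0$. Put $\operatorname{disp}_K(y)=\sup_{k\in K}d(y,\rho(k)y)$. An $(r,s,\varepsilon,\delta,K)$-almost action of $\Gamma$ on $X$ at $x$ is a map $\rho:K^s\times B(x,r)\to X$, $(a,y)\mapsto\rho(a)y$, such that 1. $(1-\varepsilon)d(y,z)\le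 d(\rho(a)y,\rho(a)z)\le(1+\varepsilon)d(y,z)$ for all $a\in K^s$ and $y,z\in B(x,r)$; 2. $\operatorname{disp}_K(x)<\delta$; 3. if $a$, $b$ and $ab$ lie in $K^s$, and $y$ and $\rho(b)y$ lie in $B(x,r)$, then $\rho(a)(\rho(b)y)=\rho(ab)y$. It is continuous if the map $\rho$ is continuous. If $X$ is a Hilbert space and $h:\Gamma\to\mathbb R$ is continuous with compact support contained in $K^s$, put $\rho(h)y=\int_\Gamma h(\gamma)\,\rho(\gamma)y\,d\mu(\gamma)$. **Theorem.** Let $f\in\mathcal U_2(\Gamma)$ and $0<C<1$. There exist $\varepsilon=\varepsilon(f,C)>0$ and positive integers $m=m(f,C)$, $s=s(f,C)$, $M=M(f,C)$ such that $h=f^{*m}$ is supported in $K^s$, and for every $\delta_0>0$ there exists $r=r(\delta_0,f,C)>0$ such that the following holds. For every Hilbert space $X$, every $0<\delta\le\delta_0$, every $x\in X$ and every continuous $(r,s,\varepsilon,\delta,K)$-almost action $\rho$ of $\Gamma$ on $X$ at $x$, the integral defining $\rho(h)x$ converges absolutely, $\rho(h)x\in B(x,r)$, and 1. $d(x,\rho(h)x)\le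 M\operatorname{disp}_K(x)$; 2. $\operatorname{disp}_K(\rho(h)x)\le C\operatorname{disp}_K(x)$. -/

import Mathlib

open MeasureTheory Set Topology
open scoped Pointwise

universe u v

/-- Property (T), in its fixed point form: every continuous isometric action of `Γ` on a Hilbert
space has a fixed point.  Hilbert spaces are real; a complex Hilbert space is a real one, and only
its metric matters here.  The closed span of an orbit of a Hilbert space in any universe has an
isometric copy in the universe of `Γ`, so it is enough to quantify over Hilbert spaces there. -/
def HasPropertyT (Γ : Type u) [Group Γ] [TopologicalSpace Γ] : Prop :=
  ∀ (H : Type u) [NormedAddCommGroup H] [InnerProductSpace ℝ H] [CompleteSpace H]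
    [MulAction Γ H],
    (∀ γ : Γ, Isometry (fun y : H => γ • y)) →
    Continuous (fun p : Γ × H => p.1 • p.2) →
    ∃ y : H, ∀ γ : Γ, γ • y = y

/-- `U(Γ)`: continuous non-negative functions with compact support and integral one. -/
structure IsAveraging {Γ : Type u} [TopologicalSpace Γ] [MeasurableSpace Γ] (μ : Measure Γ)
    (f : Γ → ℝ) : Prop where
  continuous : Continuous f
  nonneg : ∀ γ, 0 ≤ f γ
  hasCompactSupport : HasCompactSupport f
  integral_eq_one : ∫ γ, f γ ∂μ = 1

/-- `U₂(Γ)`: the functions in `U(Γ)` which are positive on `K²`, the set of products of two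
elements of `K`. -/
structure IsAveragingTwo {Γ : Type u} [Group Γ] [TopologicalSpace Γ] [MeasurableSpace Γ]
    (μ : Measure Γ) (K : Set Γ) (f : Γ → ℝ) : Prop extends IsAveraging μ f where
  pos : ∀ γ ∈ K ^ 2, 0 < f γ

/-- Convolution on a group with respect to the (left Haar) measure `μ`:
`(f * g)(γ) = ∫ f(t) g(t⁻¹γ) dμ(t)`. -/
noncomputable def groupConv {Γ : Type u} [Group Γ] [MeasurableSpace Γ] (μ : Measure Γ)
    (f g : Γ → ℝ) : Γ → ℝ :=
  fun γ => ∫ t, f t * g (t⁻¹ * γ) ∂μ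

/-- The `d`-fold convolution of `f` with itself, for `d ≥ 1`; the value at `d = 0` is never
used. -/
noncomputable def groupConvPow {Γ : Type u} [Group Γ] [MeasurableSpace Γ] (μ : Measure Γ)
    (f : Γ → ℝ) : ℕ → Γ → ℝ
  | 0 => 0
  | 1 => f
  | (n + 2) => groupConv μ f (groupConvPow μ f (n + 1))

/-- The map `φ` is an `ε`-almost isometry on the set `B`. -/
def IsAlmostIsometryOn {X : Type v} [PseudoMetricSpace X] (ε : ℝ) (φ : X → X) (B : Set X) :
    Prop :=
  ∀ y ∈ B, ∀ z ∈ B,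
    (1 - ε) * dist y z ≤ dist (φ y) (φ z) ∧ dist (φ y) (φ z) ≤ (1 + ε) * dist y z

/-- The `K`-displacement of `y` under `ρ`: the supremum of `d(y, ρ(k) y)` over `k ∈ K`. -/
noncomputable def dispK {Γ : Type u} {X : Type v} [PseudoMetricSpace X] (K : Set Γ)
    (ρ : Γ → X → X) (y : X) : ℝ :=
  sSup ((fun k => dist y (ρ k y)) '' K)

/-- An `(r, s, ε, δ, K)`-almost action of `Γ` on `X` at `x`.  The partially defined map on
`K ^ s × B(x, r)` is represented by a total function `ρ`; nothing is required of its values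
elsewhere.  That the displacement of `x` is less than `δ` includes that it is finite. -/
structure IsAlmostAction {Γ : Type u} [Group Γ] {X : Type v} [PseudoMetricSpace X]
    (K : Set Γ) (r : ℝ) (s : ℕ) (ε δ : ℝ) (x : X) (ρ : Γ → X → X) : Prop where
  almostIsometry : ∀ d ∈ K ^ s, IsAlmostIsometryOn ε (ρ d) (Metric.ball x r)
  bddAbove : BddAbove ((fun k => dist x (ρ k x)) '' K)
  disp_lt : dispK K ρ x < δ
  comp : ∀ a b : Γ, a ∈ K ^ s → b ∈ K ^ s → a * b ∈ K ^ s →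
    ∀ y ∈ Metric.ball x r, ρ b y ∈ Metric.ball x r → ρ a (ρ b y) = ρ (a * b) y

/-- The averaging operator `ρ(h) y = ∫ h(γ) ρ(γ) y dμ(γ)`. -/
noncomputable def averageOp {Γ : Type u} [MeasurableSpace Γ] (μ : Measure Γ) {X : Type v}
    [NormedAddCommGroup X] [NormedSpace ℝ X] (ρ : Γ → X → X) (h : Γ → ℝ) (y : X) : X :=
  ∫ γ, h γ • ρ γ y ∂μ

/-! For genuine isometric actions, property (T) gives a constant `D`, valid for all actions at once,
with distance to the fixed points at most `D` times the displacement: otherwise rescaled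
counterexamples could be put into one Hilbert sum whose action has no fixed point
(`HasPropertyT.exists_fixed_dist_le`). Averaging an orbit over `f` then contracts the distance to
the fixed points by a uniform factor. Replacing `y` by its average lowers the squared distance to a
fixed point `z` by exactly the variance of the orbit. If the variance is large, this is a gain; if
it is small, the average has small displacement, since `f` is bounded below on `K ^ 2`, and so lies
close to some other fixed point. Hence some `m` makes the displacement of the `m`-th iterate as
small as desired, uniformly (`HasPropertyT.exists_iterate_avg_disp_le`).

The passage to almost actions is by compactness. Were the estimate to fail for ever better rescaled
orbits `ω n`, the ultralimit of the inner products of the integrals `∫ φ • ω n` would define a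
semi-inner product on test functions `φ` of integral zero. Left translation preserves it, because
for zero mean `φ` the norm of `∫ φ • ω n` depends only on distances between points of the orbit. The
completion carries a true affine isometric action, in which averaging is convolution with `f`, and
the previous result gives a contradiction (`HasPropertyT.exists_norm_integral_translate_sub_le`).

Finally, an almost isometry of a Hilbert space nearly commutes with means (`norm_mean_sub_sq_le`),
so the `h`-mean of the orbit `ρ(kt)x` is close to `ρ(k)ρ(h)x`, and by the uniform estimate it is
close to `ρ(h)x` as well. -/

/-! ### Powers of the generating set. -/

section Powers

variable {Γ : Type u} [Group Γ] {K : Set Γ}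

theorem mem_pow_of_le (h1 : (1 : Γ) ∈ K) {i j : ℕ} (hij : i ≤ j) {γ : Γ} (h : γ ∈ K ^ i) :
    γ ∈ K ^ j :=
  Set.pow_subset_pow_right h1 hij h

theorem mul_mem_pow_add {i j : ℕ} {a b : Γ} (ha : a ∈ K ^ i) (hb : b ∈ K ^ j) :
    a * b ∈ K ^ (i + j) := by
  rw [pow_add]; exact Set.mul_mem_mul ha hb

variable [TopologicalSpace Γ] [IsTopologicalGroup Γ]

theorem isCompact_pow (hK : IsCompact K) (n : ℕ) : IsCompact (K ^ n) := by
  induction n with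
  | zero => rw [pow_zero]; exact isCompact_singleton
  | succ n ih => rw [pow_succ]; exact ih.mul hK

theorem pow_succ_mem_nhds (hK : K ∈ 𝓝 (1 : Γ)) {n : ℕ} {γ : Γ} (h : γ ∈ K ^ n) :
    K ^ (n + 1) ∈ 𝓝 γ := by
  have h2 : (fun t => γ * t) '' K ∈ 𝓝 γ := by
    have := (Homeomorph.mulLeft γ).isOpenMap.image_mem_nhds hK
    simpa using this
  refine Filter.mem_of_superset h2 ?_
  rintro _ ⟨k, hk, rfl⟩
  rw [pow_succ]
  exact Set.mul_mem_mul h hk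

theorem exists_subset_pow (hK : K ∈ 𝓝 (1 : Γ)) (hgen : ∀ γ : Γ, ∃ n : ℕ, γ ∈ K ^ n)
    {Q : Set Γ} (hQ : IsCompact Q) : ∃ n : ℕ, Q ⊆ K ^ n := by
  have h1 : (1 : Γ) ∈ K := mem_of_mem_nhds hK
  refine hQ.induction_on (p := fun S => ∃ n : ℕ, S ⊆ K ^ n) ⟨0, empty_subset _⟩ ?_ ?_ ?_
  · rintro S T hST ⟨n, hn⟩
    exact ⟨n, hST.trans hn⟩
  · rintro S T ⟨n, hn⟩ ⟨m, hm⟩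
    refine ⟨max n m, union_subset (hn.trans ?_) (hm.trans ?_)⟩
    · exact Set.pow_subset_pow_right h1 (le_max_left _ _)
    · exact Set.pow_subset_pow_right h1 (le_max_right _ _)
  · intro γ _
    obtain ⟨n, hn⟩ := hgen γ
    exact ⟨_, mem_nhdsWithin_of_mem_nhds (pow_succ_mem_nhds hK hn), n + 1, Subset.rfl⟩

end Powers

/-! ### Weighted means and variances in a Hilbert space. -/

section Weights

theorem integrable_smul_of_continuousOn {Γ : Type u} [TopologicalSpace Γ] [T2Space Γ]
    [MeasurableSpace Γ] [BorelSpace Γ] {μ : Measure Γ} [IsFiniteMeasureOnCompacts μ]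
    {X : Type v} [NormedAddCommGroup X] [NormedSpace ℝ X]
    {Q : Set Γ} (hQ : IsCompact Q) {φ : Γ → ℝ} (hφ : Continuous φ) (hφ0 : ∀ t, t ∉ Q → φ t = 0)
    {F : Γ → X} (hF : ContinuousOn F Q) : Integrable (fun t => φ t • F t) μ := by
  have h1 : IntegrableOn (fun t => φ t • F t) Q μ :=
    (hφ.continuousOn.smul hF).integrableOn_compact hQ
  refine (integrableOn_iff_integrable_of_support_subset ?_).1 h1
  intro t ht
  by_contra h
  exact ht (by simp [hφ0 t h])

theorem weight_mul_norm_sub_sq {α : Type u} {X : Type v} [NormedAddCommGroup X]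
    [InnerProductSpace ℝ X] (w : α → ℝ) (F : α → X) (z : X) (t : α) :
    w t * ‖F t - z‖ ^ 2 = w t * ‖F t‖ ^ 2 - 2 * inner ℝ z (w t • F t) + w t * ‖z‖ ^ 2 := by
  rw [norm_sub_sq_real, real_inner_smul_right, real_inner_comm]; ring

variable {α : Type u} [MeasurableSpace α] {μ : Measure α}

theorem integral_sub_add {f g h : α → ℝ} (hf : Integrable f μ) (hg : Integrable g μ)
    (hh : Integrable h μ) :
    ∫ t, (f t - g t + h t) ∂μ = ∫ t, f t ∂μ - ∫ t, g t ∂μ + ∫ t, h t ∂μ := by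
  rw [← integral_sub hf hg]
  exact integral_add (hf.sub hg) hh

variable {X : Type v} [NormedAddCommGroup X] [InnerProductSpace ℝ X]

theorem integrable_weight_norm_sub_sq {w : α → ℝ} {F : α → X} (hw : Integrable w μ)
    (hF : Integrable (fun t => w t • F t) μ) (hF2 : Integrable (fun t => w t * ‖F t‖ ^ 2) μ)
    (z : X) : Integrable (fun t => w t * ‖F t - z‖ ^ 2) μ := by
  simp_rw [weight_mul_norm_sub_sq w F z]
  exact (hF2.sub ((hF.const_inner z).const_mul 2)).add (hw.mul_const _)

variable [CompleteSpace X]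

theorem integral_weight_norm_sub_sq {w : α → ℝ} {F : α → X} (hw : Integrable w μ)
    (hF : Integrable (fun t => w t • F t) μ) (hF2 : Integrable (fun t => w t * ‖F t‖ ^ 2) μ)
    (z : X) : ∫ t, w t * ‖F t - z‖ ^ 2 ∂μ =
      ∫ t, w t * ‖F t‖ ^ 2 ∂μ - 2 * inner ℝ z (∫ t, w t • F t ∂μ) + (∫ t, w t ∂μ) * ‖z‖ ^ 2 := by
  simp_rw [weight_mul_norm_sub_sq w F z]
  refine (integral_sub_add hF2 ((hF.const_inner z).const_mul 2) (hw.mul_const _)).trans ?_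
  rw [integral_const_mul, integral_mul_const, integral_inner hF]

theorem integrable_weight_double {w : α → ℝ} {F : α → X} (hw : Integrable w μ)
    (hF : Integrable (fun t => w t • F t) μ) (hF2 : Integrable (fun t => w t * ‖F t‖ ^ 2) μ) :
    Integrable (fun s => w s * ∫ t, w t * ‖F t - F s‖ ^ 2 ∂μ) μ := by
  simp_rw [integral_weight_norm_sub_sq hw hF hF2]
  have h : (fun s => w s * (∫ t, w t * ‖F t‖ ^ 2 ∂μ - 2 * inner ℝ (F s) (∫ t, w t • F t ∂μ) +
      (∫ t, w t ∂μ) * ‖F s‖ ^ 2)) = fun s => w s * (∫ t, w t * ‖F t‖ ^ 2 ∂μ) -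
      2 * inner ℝ (∫ t, w t • F t ∂μ) (w s • F s) + (∫ t, w t ∂μ) * (w s * ‖F s‖ ^ 2) := by
    funext s
    rw [real_inner_smul_right, real_inner_comm]; ring
  rw [h]
  exact ((hw.mul_const _).sub ((hF.const_inner _).const_mul 2)).add (hF2.const_mul _)

/-- The total mass of `w` is left free on purpose. Mass one expresses the variance, and mass zero
the squared norm of `∫ w • F`, through the distances `‖F t - F s‖` alone. -/
theorem integral_weight_double {w : α → ℝ} {F : α → X} (hw : Integrable w μ)
    (hF : Integrable (fun t => w t • F t) μ) (hF2 : Integrable (fun t => w t * ‖F t‖ ^ 2) μ) :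
    ∫ s, w s * ∫ t, w t * ‖F t - F s‖ ^ 2 ∂μ ∂μ =
      2 * ((∫ t, w t ∂μ) * ∫ t, w t * ‖F t‖ ^ 2 ∂μ - ‖∫ t, w t • F t ∂μ‖ ^ 2) := by
  simp_rw [integral_weight_norm_sub_sq hw hF hF2]
  have h : (fun s => w s * (∫ t, w t * ‖F t‖ ^ 2 ∂μ - 2 * inner ℝ (F s) (∫ t, w t • F t ∂μ) +
      (∫ t, w t ∂μ) * ‖F s‖ ^ 2)) = fun s => w s * (∫ t, w t * ‖F t‖ ^ 2 ∂μ) -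
      2 * inner ℝ (∫ t, w t • F t ∂μ) (w s • F s) + (∫ t, w t ∂μ) * (w s * ‖F s‖ ^ 2) := by
    funext s
    rw [real_inner_smul_right, real_inner_comm]; ring
  rw [h]
  refine (integral_sub_add (hw.mul_const _) ((hF.const_inner _).const_mul 2)
    (hF2.const_mul _)).trans ?_
  rw [integral_const_mul, integral_mul_const, integral_inner hF, real_inner_self_eq_norm_sq,
    integral_const_mul]
  ring

/-- With weights of total mass one, the mean square distance to `z` is the variance plus the
square of the distance from `z` to the mean. -/
theorem integral_weight_norm_sub_sq_eq {w : α → ℝ} {F : α → X} (hw : Integrable w μ)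
    (hw1 : ∫ t, w t ∂μ = 1)
    (hF : Integrable (fun t => w t • F t) μ) (hF2 : Integrable (fun t => w t * ‖F t‖ ^ 2) μ)
    (z : X) : ∫ t, w t * ‖F t - z‖ ^ 2 ∂μ =
      ∫ t, w t * ‖F t - ∫ t, w t • F t ∂μ‖ ^ 2 ∂μ + ‖(∫ t, w t • F t ∂μ) - z‖ ^ 2 := by
  rw [integral_weight_norm_sub_sq hw hF hF2, integral_weight_norm_sub_sq hw hF hF2, hw1,
    real_inner_self_eq_norm_sq, norm_sub_sq_real, real_inner_comm]
  ring

end Weights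

/-! ### Isometric actions and fixed points. -/

/-- A continuous action of `Γ` by isometries of a real Hilbert space. -/
structure IsomAction (Γ : Type u) [Group Γ] [TopologicalSpace Γ] where
  H : Type u
  [normed : NormedAddCommGroup H]
  [inner : InnerProductSpace ℝ H]
  [complete : CompleteSpace H]
  act : Γ → H → H
  one_act : ∀ y, act 1 y = y
  mul_act : ∀ a b y, act (a * b) y = act a (act b y)
  dist_act : ∀ a y z, dist (act a y) (act a z) = dist y z
  continuous_act : ∀ y, Continuous fun a => act a y

attribute [instance] IsomAction.normed IsomAction.inner IsomAction.complete

section FixedPoints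

variable {Γ : Type u} [Group Γ] [TopologicalSpace Γ]

theorem HasPropertyT.exists_fixed (hT : HasPropertyT Γ) (𝒜 : IsomAction Γ) :
    ∃ y : 𝒜.H, ∀ γ, 𝒜.act γ y = y := by
  let : MulAction Γ 𝒜.H :=
    { smul := 𝒜.act
      one_smul := 𝒜.one_act
      mul_smul := 𝒜.mul_act }
  refine hT 𝒜.H (fun γ => Isometry.of_dist_eq (𝒜.dist_act γ)) ?_
  rw [continuous_iff_continuousAt]
  rintro ⟨g, y⟩
  change Filter.Tendsto (fun p : Γ × 𝒜.H => 𝒜.act p.1 p.2) (𝓝 (g, y)) (𝓝 (𝒜.act g y))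
  rw [tendsto_iff_dist_tendsto_zero]
  -- Each group element acts isometrically, so continuity of orbit maps already gives joint
  -- continuity.
  have h1 : Filter.Tendsto (fun p : Γ × 𝒜.H => dist p.2 y + dist (𝒜.act p.1 y) (𝒜.act g y))
      (𝓝 (g, y)) (𝓝 (dist y y + dist (𝒜.act g y) (𝒜.act g y))) := by
    have hc : Continuous (fun p : Γ × 𝒜.H => dist p.2 y + dist (𝒜.act p.1 y) (𝒜.act g y)) := by
      have := (𝒜.continuous_act y).comp (continuous_fst (X := Γ) (Y := 𝒜.H))
      exact (continuous_snd.dist continuous_const).add (this.dist continuous_const)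
    exact hc.tendsto (g, y)
  rw [dist_self, dist_self, add_zero] at h1
  refine squeeze_zero (fun _ => dist_nonneg) (fun p => ?_) h1
  refine (dist_triangle _ (𝒜.act p.1 y) _).trans ?_
  rw [𝒜.dist_act]

theorem IsomAction.dist_act_le_of_mem_pow (𝒜 : IsomAction Γ) {K : Set Γ} {y : 𝒜.H} {d : ℝ}
    (h : ∀ k ∈ K, dist (𝒜.act k y) y ≤ d) {j : ℕ} {γ : Γ} (hγ : γ ∈ K ^ j) :
    dist (𝒜.act γ y) y ≤ j * d := by
  induction j generalizing γ with
  | zero =>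
    rw [pow_zero, Set.mem_one] at hγ
    simp [hγ, 𝒜.one_act]
  | succ j ih =>
    rw [pow_succ'] at hγ
    obtain ⟨k, hk, γ', hγ', rfl⟩ := Set.mem_mul.1 hγ
    rw [𝒜.mul_act]
    refine (dist_triangle _ (𝒜.act k y) _).trans ?_
    rw [𝒜.dist_act]
    push_cast
    linarith [ih hγ', h k hk]

end FixedPoints

/-! ### Hilbert sums of rescaled actions and the uniform fixed point estimate. -/

section HilbertSum

theorem memℓp_two_iff {G : ℕ → Type u} [∀ n, NormedAddCommGroup (G n)] {w : ∀ n, G n} :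
    Memℓp w 2 ↔ Summable fun n => ‖w n‖ ^ 2 := by
  rw [memℓp_gen_iff (by norm_num)]
  simp

theorem lp_two_norm_sq {G : ℕ → Type u} [∀ n, NormedAddCommGroup (G n)] (w : lp G 2) :
    ‖w‖ ^ 2 = ∑' n, ‖w n‖ ^ 2 := by
  have := lp.norm_rpow_eq_tsum (p := 2) (by norm_num) w
  simpa using this

theorem summable_sq_add {a b : ℕ → ℝ} (ha : Summable fun n => a n ^ 2)
    (hb : Summable fun n => b n ^ 2) : Summable fun n => (a n + b n) ^ 2 := by
  refine Summable.of_nonneg_of_le (fun n => sq_nonneg _) (fun n => ?_)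
    ((ha.mul_left 2).add (hb.mul_left 2))
  nlinarith [sq_nonneg (a n - b n)]

variable {Γ : Type u} [Group Γ] [TopologicalSpace Γ] [IsTopologicalGroup Γ] {K : Set Γ}

/-- The coordinates of the rescaled action on a Hilbert sum whose origin is the family `v`. -/
noncomputable def sumCoord (𝒜 : ℕ → IsomAction Γ) (v : ∀ n, (𝒜 n).H) (c : ℕ → ℝ) (g : Γ)
    (w : ∀ n, (𝒜 n).H) (n : ℕ) : (𝒜 n).H :=
  c n • ((𝒜 n).act g (v n + (c n)⁻¹ • w n) - v n)

variable {𝒜 : ℕ → IsomAction Γ} {v : ∀ n, (𝒜 n).H} {c : ℕ → ℝ}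

omit [IsTopologicalGroup Γ] in
theorem norm_sumCoord_sub (hc : ∀ n, 0 < c n) (g : Γ) (w w' : ∀ n, (𝒜 n).H) (n : ℕ) :
    ‖sumCoord 𝒜 v c g w n - sumCoord 𝒜 v c g w' n‖ = ‖w n - w' n‖ := by
  unfold sumCoord
  rw [← smul_sub, sub_sub_sub_cancel_right, norm_smul, ← dist_eq_norm, (𝒜 n).dist_act,
    dist_eq_norm, add_sub_add_left_eq_sub, ← smul_sub, norm_smul, norm_inv, ← mul_assoc,
    mul_inv_cancel₀ (by simpa using (hc n).ne'), one_mul]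

-- The image of the origin has `n`-th coordinate at most `j * (1 / 2) ^ n`, which is square
-- summable; this is what keeps the summed action inside `lp`.
omit [IsTopologicalGroup Γ] in
theorem norm_sumCoord_le (hc : ∀ n, 0 < c n)
    (h : ∀ n, ∀ k ∈ K, dist ((𝒜 n).act k (v n)) (v n) ≤ (c n)⁻¹ * (1 / 2) ^ n)
    {j : ℕ} {g : Γ} (hg : g ∈ K ^ j) (w : ∀ n, (𝒜 n).H) (n : ℕ) :
    ‖sumCoord 𝒜 v c g w n‖ ≤ ‖w n‖ + j * (1 / 2) ^ n := by
  have h1 := norm_sumCoord_sub (v := v) hc g w 0 n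
  have h2 : ‖sumCoord 𝒜 v c g 0 n‖ ≤ j * (1 / 2) ^ n := by
    unfold sumCoord
    have := (𝒜 n).dist_act_le_of_mem_pow (h n) hg
    rw [Pi.zero_apply, smul_zero, add_zero, norm_smul, ← dist_eq_norm, Real.norm_eq_abs,
      abs_of_pos (hc n)]
    calc c n * dist ((𝒜 n).act g (v n)) (v n) ≤ c n * (j * ((c n)⁻¹ * (1 / 2) ^ n)) :=
          mul_le_mul_of_nonneg_left this (hc n).le
      _ = j * (1 / 2) ^ n := by field_simp [(hc n).ne']
  rw [Pi.zero_apply, sub_zero] at h1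
  calc _ = ‖(sumCoord 𝒜 v c g w n - sumCoord 𝒜 v c g 0 n) + sumCoord 𝒜 v c g 0 n‖ := by
        rw [sub_add_cancel]
    _ ≤ _ := (norm_add_le _ _).trans (by rw [h1]; gcongr)

theorem summable_sq_mul_half_pow (J : ℝ) : Summable fun n : ℕ => (J * (1 / 2) ^ n) ^ 2 := by
  have : (fun n : ℕ => (J * (1 / 2) ^ n) ^ 2) = fun n : ℕ => J ^ 2 * (1 / 4 : ℝ) ^ n := by
    funext n
    rw [mul_pow, ← pow_mul, mul_comm n 2, pow_mul]; norm_num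
  rw [this]
  exact (summable_geometric_of_lt_one (by norm_num) (by norm_num)).mul_left _

/-- The Hilbert sum of rescaled isometric actions based at points of summable displacement. -/
noncomputable def sumAction (hK : K ∈ 𝓝 (1 : Γ)) (hgen : ∀ γ : Γ, ∃ n : ℕ, γ ∈ K ^ n)
    (𝒜 : ℕ → IsomAction Γ) (v : ∀ n, (𝒜 n).H) (c : ℕ → ℝ) (hc : ∀ n, 0 < c n)
    (h : ∀ n, ∀ k ∈ K, dist ((𝒜 n).act k (v n)) (v n) ≤ (c n)⁻¹ * (1 / 2) ^ n) :
    IsomAction Γ where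
  H := lp (fun n => (𝒜 n).H) 2
  act g w := ⟨sumCoord 𝒜 v c g w, memℓp_two_iff.2 (by
    obtain ⟨j, hj⟩ := hgen g
    refine Summable.of_nonneg_of_le (fun n => sq_nonneg _)
      (fun n => pow_le_pow_left₀ (norm_nonneg _) (norm_sumCoord_le hc h hj w n) 2) ?_
    exact summable_sq_add (memℓp_two_iff.1 (lp.memℓp w)) (summable_sq_mul_half_pow _))⟩
  one_act w := by
    ext n
    change sumCoord 𝒜 v c 1 w n = w n
    rw [sumCoord, (𝒜 n).one_act, add_sub_cancel_left, smul_inv_smul₀ (hc n).ne']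
  mul_act a b w := by
    ext n
    change sumCoord 𝒜 v c (a * b) w n = sumCoord 𝒜 v c a (sumCoord 𝒜 v c b w) n
    unfold sumCoord
    rw [inv_smul_smul₀ (hc n).ne', (𝒜 n).mul_act, add_sub_cancel]
  dist_act a w w' := by
    rw [dist_eq_norm, dist_eq_norm, ← sq_eq_sq₀ (norm_nonneg _) (norm_nonneg _),
      lp_two_norm_sq, lp_two_norm_sq]
    refine tsum_congr fun n => ?_
    exact congrArg (· ^ 2) (norm_sumCoord_sub hc a w w' n)
  continuous_act w := by
    rw [continuous_iff_continuousAt]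
    intro g₀
    obtain ⟨j, hj⟩ := hgen g₀
    rw [ContinuousAt, tendsto_iff_norm_sub_tendsto_zero]
    have key : Filter.Tendsto (fun g => ∑' n, ‖sumCoord 𝒜 v c g w n - sumCoord 𝒜 v c g₀ w n‖ ^ 2)
        (𝓝 g₀) (𝓝 (∑' _ : ℕ, (0 : ℝ))) := by
      -- Elements near `g₀` lie in `K ^ (j + 1)`, so one dominating sequence serves a whole
      -- neighbourhood; the factor `4` is the square of the two terms in the triangle inequality.
      have hw : Summable fun n => (‖w n‖ + ((j + 1 : ℕ) : ℝ) * (1 / 2) ^ n) ^ 2 :=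
        summable_sq_add (memℓp_two_iff.1 (lp.memℓp w)) (summable_sq_mul_half_pow _)
      refine tendsto_tsum_of_dominated_convergence (hw.mul_left 4) (fun n => ?_) ?_
      · have hcont : Continuous fun g => ‖sumCoord 𝒜 v c g w n - sumCoord 𝒜 v c g₀ w n‖ ^ 2 := by
          unfold sumCoord
          have := (𝒜 n).continuous_act (v n + (c n)⁻¹ • w n)
          fun_prop
        simpa using hcont.tendsto g₀
      · filter_upwards [pow_succ_mem_nhds hK hj] with g hg n
        have h1 := norm_sumCoord_le hc h hg w n
        have h2 := norm_sumCoord_le hc h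
          (mem_pow_of_le (mem_of_mem_nhds hK) (Nat.le_succ j) hj) w n
        rw [Real.norm_eq_abs, abs_of_nonneg (sq_nonneg _)]
        have h3 := (norm_sub_le (sumCoord 𝒜 v c g w n) (sumCoord 𝒜 v c g₀ w n)).trans
          (add_le_add h1 h2)
        refine (pow_le_pow_left₀ (norm_nonneg _) h3 2).trans (le_of_eq ?_)
        push_cast; ring
    rw [tsum_zero] at key
    have h2 := key.sqrt
    rw [Real.sqrt_zero] at h2
    refine h2.congr fun g => ?_
    rw [Real.sqrt_eq_iff_mul_self_eq (tsum_nonneg fun n => sq_nonneg _) (norm_nonneg _), ← sq,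
      lp_two_norm_sq]
    rfl

/-- A single fixed vector `w` of the Hilbert sum gives a fixed point in every summand, and undoing
the rescaling places it within `(c n)⁻¹ * ‖w‖` of `v n`. -/
theorem exists_fixed_of_sequence (hT : HasPropertyT Γ) (hK : K ∈ 𝓝 (1 : Γ))
    (hgen : ∀ γ : Γ, ∃ n : ℕ, γ ∈ K ^ n) (hc : ∀ n, 0 < c n)
    (h : ∀ n, ∀ k ∈ K, dist ((𝒜 n).act k (v n)) (v n) ≤ (c n)⁻¹ * (1 / 2) ^ n) :
    ∃ W : ℝ, ∀ n, ∃ y : (𝒜 n).H, (∀ γ, (𝒜 n).act γ y = y) ∧ dist (v n) y ≤ (c n)⁻¹ * W := by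
  obtain ⟨w, hw⟩ := hT.exists_fixed (sumAction hK hgen 𝒜 v c hc h)
  change lp (fun n => (𝒜 n).H) 2 at w
  refine ⟨‖w‖, fun n => ⟨v n + (c n)⁻¹ • w n, fun γ => ?_, ?_⟩⟩
  · have h1 : sumCoord 𝒜 v c γ w n = w n := congrArg (fun z : lp (fun n => (𝒜 n).H) 2 => z n) (hw γ)
    unfold sumCoord at h1
    have h2 := (inv_smul_eq_iff₀ (hc n).ne').2 h1.symm
    rw [← sub_eq_iff_eq_add']
    exact h2.symm
  · rw [dist_self_add_right, norm_smul, norm_inv, Real.norm_eq_abs, abs_of_pos (hc n)]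
    exact mul_le_mul_of_nonneg_left (lp.norm_apply_le_norm (by norm_num) w n)
      (inv_nonneg.2 (hc n).le)

/-- Under property (T) the distance to the fixed points is controlled by the displacement,
uniformly over all actions. -/
theorem HasPropertyT.exists_fixed_dist_le (hT : HasPropertyT Γ) (hK : K ∈ 𝓝 (1 : Γ))
    (hgen : ∀ γ : Γ, ∃ n : ℕ, γ ∈ K ^ n) :
    ∃ D : ℝ, 0 < D ∧ ∀ (𝒜 : IsomAction Γ) (v : 𝒜.H) (d : ℝ), 0 < d →
      (∀ k ∈ K, dist (𝒜.act k v) v ≤ d) →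
      ∃ y, (∀ γ, 𝒜.act γ y = y) ∧ dist v y ≤ D * d := by
  by_contra! hcon
  -- Counterexamples to the constants `4 ^ n` are rescaled by `(1 / 2) ^ n / d n`. The sum yields
  -- fixed points within `2 ^ n * d n * W`, which contradicts the bound `4 ^ n * d n` as soon as `2
  -- ^ n > W`.
  choose 𝒜 v d hd hdisp hfar using fun n : ℕ => hcon (4 ^ n) (by positivity)
  obtain ⟨W, hW⟩ := exists_fixed_of_sequence (𝒜 := 𝒜) (v := v) (c := fun n => (1 / 2) ^ n * (d n)⁻¹)
    hT hK hgen (fun n => mul_pos (by positivity) (inv_pos.2 (hd n))) (fun n k hk => by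
      refine (hdisp n k hk).trans (le_of_eq ?_)
      have := (hd n).ne'
      field_simp)
  obtain ⟨n, hn⟩ := pow_unbounded_of_one_lt W (one_lt_two)
  obtain ⟨y, hy, hle⟩ := hW n
  have h1 := hfar n y hy
  have h2 : ((1 / 2 : ℝ) ^ n * (d n)⁻¹)⁻¹ * W = 2 ^ n * d n * W := by
    rw [mul_inv, inv_inv, one_div, inv_pow, inv_inv]
  rw [h2] at hle
  have h3 : (4 : ℝ) ^ n = 2 ^ n * 2 ^ n := by rw [← mul_pow]; norm_num
  rw [h3] at h1
  have h4 : 0 < (2 : ℝ) ^ n * d n := mul_pos (by positivity) (hd n)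
  nlinarith [mul_lt_mul_of_pos_left hn h4]

end HilbertSum

/-! ### Averaging contracts the distance to the fixed points. -/

section Averages

variable {Γ : Type u} [Group Γ] [TopologicalSpace Γ] [IsTopologicalGroup Γ] [T2Space Γ]
  [MeasurableSpace Γ] [BorelSpace Γ] {μ : Measure Γ} [μ.IsHaarMeasure] {K : Set Γ} {f : Γ → ℝ}

omit [Group Γ] [IsTopologicalGroup Γ] [T2Space Γ] [BorelSpace Γ] in
theorem IsAveraging.eq_zero (_ : IsAveraging μ f) : ∀ t, t ∉ tsupport f → f t = 0 :=
  fun _ ht => image_eq_zero_of_notMem_tsupport ht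

omit [IsTopologicalGroup Γ] [T2Space Γ] in
theorem IsAveraging.integrable (hf : IsAveraging μ f) : Integrable f μ :=
  hf.continuous.integrable_of_hasCompactSupport hf.hasCompactSupport

omit [IsTopologicalGroup Γ] in
theorem IsAveraging.integrable_smul (hf : IsAveraging μ f) {X : Type v} [NormedAddCommGroup X]
    [NormedSpace ℝ X] {F : Γ → X} (hF : Continuous F) : Integrable (fun t => f t • F t) μ :=
  integrable_smul_of_continuousOn hf.hasCompactSupport hf.continuous hf.eq_zero hF.continuousOn

/-- The barycentre of the orbit of `y` with respect to the weight `f`. -/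
noncomputable def IsomAction.avg (𝒜 : IsomAction Γ) (μ : Measure Γ) (f : Γ → ℝ) (y : 𝒜.H) : 𝒜.H :=
  ∫ t, f t • 𝒜.act t y ∂μ

/-- The variance of the orbit of `y` with respect to the weight `f`. -/
noncomputable def IsomAction.energy (𝒜 : IsomAction Γ) (μ : Measure Γ) (f : Γ → ℝ) (y : 𝒜.H) : ℝ :=
  ∫ t, f t * ‖𝒜.act t y - 𝒜.avg μ f y‖ ^ 2 ∂μ

-- All points of the orbit of `y` are equally far from the fixed point `z`, so their mean square
-- distance to `z` is `‖y - z‖ ^ 2`.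
omit [IsTopologicalGroup Γ] in
theorem IsomAction.norm_avg_sub_sq (𝒜 : IsomAction Γ) (hf : IsAveraging μ f) (y : 𝒜.H) {z : 𝒜.H}
    (hz : ∀ γ, 𝒜.act γ z = z) :
    ‖y - z‖ ^ 2 = 𝒜.energy μ f y + ‖𝒜.avg μ f y - z‖ ^ 2 := by
  have h := integral_weight_norm_sub_sq_eq (F := fun t => 𝒜.act t y) hf.integrable
    hf.integral_eq_one (hf.integrable_smul (𝒜.continuous_act y))
    (hf.integrable_smul ((𝒜.continuous_act y).norm.pow 2)) z
  have h2 : ∀ t, f t * ‖𝒜.act t y - z‖ ^ 2 = f t * ‖y - z‖ ^ 2 := fun t => by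
    rw [← dist_eq_norm, ← dist_eq_norm, ← 𝒜.dist_act t y z, hz]
  simp_rw [h2] at h
  rw [integral_mul_const, hf.integral_eq_one, one_mul] at h
  exact h

/-- For `k` and `s` in `K` both `s` and `k * s` lie in `K ^ 2`, where `f` has a positive minimum; so
the variance controls the distances of both orbit points to the barycentre, on average over `s ∈ K`.
-/
theorem exists_disp_avg_le (hKc : IsCompact K) (hK : K ∈ 𝓝 (1 : Γ))
    (hf : IsAveragingTwo μ K f) :
    ∃ C₁ : ℝ, 0 < C₁ ∧ ∀ (𝒜 : IsomAction Γ) (y : 𝒜.H), ∀ k ∈ K,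
      dist (𝒜.act k (𝒜.avg μ f y)) (𝒜.avg μ f y) ^ 2 ≤ C₁ * 𝒜.energy μ f y := by
  have h1 : (1 : Γ) ∈ K := mem_of_mem_nhds hK
  have hne : (K ^ 2).Nonempty := ⟨1, mem_pow_of_le h1 (by norm_num : 1 ≤ 2) (by simpa using h1)⟩
  obtain ⟨t₀, ht₀, hmin⟩ := (isCompact_pow hKc 2).exists_isMinOn hne hf.continuous.continuousOn
  have hc : 0 < f t₀ := hf.pos t₀ ht₀
  set c := f t₀
  have hKm : MeasurableSet K := hKc.measurableSet
  have hμ : 0 < μ.real K :=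
    ENNReal.toReal_pos (Measure.measure_pos_of_mem_nhds μ hK).ne' hKc.measure_lt_top.ne
  refine ⟨4 / (c * μ.real K), by positivity, fun 𝒜 y k hk => ?_⟩
  set z := 𝒜.avg μ f y
  set G : Γ → ℝ := fun u => ‖𝒜.act u y - z‖ ^ 2 with hG
  have hGc : Continuous G := ((𝒜.continuous_act y).sub continuous_const).norm.pow 2
  have hG0 : ∀ u, 0 ≤ G u := fun u => sq_nonneg _
  have hfG : Integrable (fun u => f u * G u) μ := hf.integrable_smul hGc
  have hle : ∀ g : Γ, (∀ s ∈ K, g * s ∈ K ^ 2) →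
      c * ∫ s in K, G (g * s) ∂μ ≤ 𝒜.energy μ f y := by
    intro g hg
    have hint : Integrable (fun s => f (g * s) * G (g * s)) μ := hfG.comp_mul_left g
    calc c * ∫ s in K, G (g * s) ∂μ = ∫ s in K, c * G (g * s) ∂μ := (integral_const_mul _ _).symm
      _ ≤ ∫ s in K, f (g * s) * G (g * s) ∂μ := by
          refine setIntegral_mono_on ?_ hint.integrableOn hKm fun s hs => ?_
          · exact (continuous_const.mul
              (hGc.comp (continuous_const_mul g))).continuousOn.integrableOn_compact hKc
          · exact mul_le_mul_of_nonneg_right (hmin (hg s hs)) (hG0 _)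
      _ ≤ ∫ s, f (g * s) * G (g * s) ∂μ :=
          setIntegral_le_integral hint
            (Filter.Eventually.of_forall fun s => mul_nonneg (hf.nonneg _) (hG0 _))
      _ = ∫ s, f s * G s ∂μ := integral_mul_left_eq_self (fun u => f u * G u) g
  have ha := hle k fun s hs => by rw [sq]; exact Set.mul_mem_mul hk hs
  have hb := hle 1 fun s hs => by rw [sq]; exact Set.mul_mem_mul h1 hs
  simp_rw [one_mul] at hb
  have hint1 : IntegrableOn (fun s => G (k * s)) K μ :=
    (hGc.comp (continuous_const_mul k)).continuousOn.integrableOn_compact hKc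
  have hint2 : IntegrableOn G K μ := hGc.continuousOn.integrableOn_compact hKc
  have hmain : μ.real K * dist (𝒜.act k z) z ^ 2 ≤
      2 * ∫ s in K, G (k * s) ∂μ + 2 * ∫ s in K, G s ∂μ := by
    rw [← integral_const_mul, ← integral_const_mul, ← integral_add (hint1.const_mul 2)
      (hint2.const_mul 2), ← smul_eq_mul, ← setIntegral_const]
    refine setIntegral_mono_on (integrableOn_const hKc.measure_lt_top.ne)
      ((hint1.const_mul 2).add (hint2.const_mul 2)) hKm fun s _ => ?_
    -- The point `k s y` is compared with `k z`, which costs the distance from `s y` to `z`, and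
    -- with `z`.
    have h3 : dist (𝒜.act k z) z ≤ dist (𝒜.act s y) z + dist (𝒜.act (k * s) y) z := by
      refine (dist_triangle_left _ _ (𝒜.act (k * s) y)).trans ?_
      rw [𝒜.mul_act, 𝒜.dist_act]
    have h4 : G s = dist (𝒜.act s y) z ^ 2 := by rw [dist_eq_norm]
    have h5 : G (k * s) = dist (𝒜.act (k * s) y) z ^ 2 := by rw [dist_eq_norm]
    rw [h4, h5]
    refine (pow_le_pow_left₀ dist_nonneg h3 2).trans ?_
    nlinarith [sq_nonneg (dist (𝒜.act s y) z - dist (𝒜.act (k * s) y) z)]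
  rw [div_mul_eq_mul_div, le_div_iff₀ (by positivity)]
  nlinarith

/-- Under property (T) averaging contracts the displacement uniformly over all actions. -/
theorem HasPropertyT.exists_iterate_avg_disp_le (hT : HasPropertyT Γ) (hKc : IsCompact K)
    (hK : K ∈ 𝓝 (1 : Γ)) (hgen : ∀ γ : Γ, ∃ n : ℕ, γ ∈ K ^ n) (hf : IsAveragingTwo μ K f)
    {c : ℝ} (hc : 0 < c) :
    ∃ m : ℕ, ∀ (𝒜 : IsomAction Γ) (y : 𝒜.H) (d : ℝ), 0 < d → (∀ k ∈ K, dist (𝒜.act k y) y ≤ d) →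
      ∀ g, dist (𝒜.act g ((𝒜.avg μ f)^[m] y)) ((𝒜.avg μ f)^[m] y) ≤ c * d := by
  obtain ⟨D, hD, hfix⟩ := hT.exists_fixed_dist_le hK hgen
  obtain ⟨C₁, hC₁, hdisp⟩ := exists_disp_avg_le hKc hK hf
  -- `θ` is chosen so that `D ^ 2 * C₁ * θ ≤ 1 - θ`: both cases below then contract by the same
  -- factor.
  set θ : ℝ := 1 / (2 * (D ^ 2 * C₁ + 1)) with hθ
  have hpos : 0 < D ^ 2 * C₁ + 1 := by positivity
  have hθ0 : 0 < θ := by positivity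
  have hθ1 : D ^ 2 * C₁ * θ + θ = 1 / 2 := by rw [hθ]; field_simp
  have hθ2 : θ ≤ 1 / 2 := by nlinarith [mul_nonneg (mul_nonneg (sq_nonneg D) hC₁.le) hθ0.le]
  have step : ∀ (𝒜 : IsomAction Γ) (y z : 𝒜.H), (∀ γ, 𝒜.act γ z = z) →
      ∃ z', (∀ γ, 𝒜.act γ z' = z') ∧ ‖𝒜.avg μ f y - z'‖ ^ 2 ≤ (1 - θ) * ‖y - z‖ ^ 2 := by
    intro 𝒜 y z hz
    have hen := 𝒜.norm_avg_sub_sq hf.toIsAveraging y hz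
    -- With large variance the same fixed point `z` serves; with small variance the average is
    -- nearly fixed and a new fixed point near it is taken.
    by_cases hlarge : θ * ‖y - z‖ ^ 2 ≤ 𝒜.energy μ f y
    · exact ⟨z, hz, by linarith⟩
    push Not at hlarge
    have hyz : 0 < ‖y - z‖ := by
      rcases (norm_nonneg (y - z)).eq_or_lt with h | h
      · rw [← h] at hen hlarge
        nlinarith [sq_nonneg ‖𝒜.avg μ f y - z‖,
          integral_nonneg (μ := μ) (f := fun t => f t * ‖𝒜.act t y - 𝒜.avg μ f y‖ ^ 2)
            fun t => mul_nonneg (hf.nonneg t) (sq_nonneg _),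
          show 𝒜.energy μ f y = ∫ t, f t * ‖𝒜.act t y - 𝒜.avg μ f y‖ ^ 2 ∂μ from rfl]
      · exact h
    obtain ⟨z', hz', hle⟩ := hfix 𝒜 (𝒜.avg μ f y) (Real.sqrt (C₁ * θ) * ‖y - z‖)
      (mul_pos (Real.sqrt_pos.2 (mul_pos hC₁ hθ0)) hyz) (fun k hk => by
        refine abs_le_of_sq_le_sq' ?_ (by positivity) |>.2
        rw [mul_pow, Real.sq_sqrt (mul_pos hC₁ hθ0).le]
        nlinarith [hdisp 𝒜 y k hk])
    refine ⟨z', hz', ?_⟩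
    rw [← dist_eq_norm]
    refine (pow_le_pow_left₀ dist_nonneg hle 2).trans ?_
    rw [mul_pow, mul_pow, Real.sq_sqrt (mul_pos hC₁ hθ0).le, ← mul_assoc]
    refine mul_le_mul_of_nonneg_right ?_ (sq_nonneg _)
    nlinarith
  have iter : ∀ (n : ℕ) (𝒜 : IsomAction Γ) (y z : 𝒜.H), (∀ γ, 𝒜.act γ z = z) →
      ∃ z', (∀ γ, 𝒜.act γ z' = z') ∧
        ‖(𝒜.avg μ f)^[n] y - z'‖ ^ 2 ≤ (1 - θ) ^ n * ‖y - z‖ ^ 2 := by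
    intro n 𝒜 y z hz
    induction n with
    | zero => exact ⟨z, hz, by simp⟩
    | succ n ih =>
      obtain ⟨z₁, hz₁, h₁⟩ := ih
      obtain ⟨z₂, hz₂, h₂⟩ := step 𝒜 ((𝒜.avg μ f)^[n] y) z₁ hz₁
      refine ⟨z₂, hz₂, ?_⟩
      rw [Function.iterate_succ_apply']
      refine h₂.trans ?_
      rw [pow_succ' (1 - θ), mul_assoc]
      exact mul_le_mul_of_nonneg_left h₁ (by linarith)
  -- The iterate ends within `c * d / 2` of a fixed point, and its displacement is at most twice
  -- that distance.
  obtain ⟨m, hm⟩ := exists_pow_lt_of_lt_one (show 0 < (c / (2 * D)) ^ 2 by positivity)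
    (show 1 - θ < 1 by linarith)
  refine ⟨m, fun 𝒜 y d hd hy g => ?_⟩
  obtain ⟨z, hz, hyz⟩ := hfix 𝒜 y d hd hy
  obtain ⟨z', hz', hle⟩ := iter m 𝒜 y z hz
  have h1 : ‖(𝒜.avg μ f)^[m] y - z'‖ ≤ c / (2 * D) * (D * d) := by
    refine abs_le_of_sq_le_sq' ?_ (by positivity) |>.2
    refine hle.trans ?_
    rw [mul_pow]
    refine mul_le_mul hm.le ?_ (sq_nonneg _) (sq_nonneg _)
    rw [← dist_eq_norm]
    exact pow_le_pow_left₀ dist_nonneg hyz 2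
  have h2 : c / (2 * D) * (D * d) = c * d / 2 := by field_simp
  rw [h2, ← dist_eq_norm] at h1
  refine (dist_triangle_right _ _ z').trans ?_
  have h3 := 𝒜.dist_act g ((𝒜.avg μ f)^[m] y) z'
  rw [hz' g] at h3
  rw [h3]
  linarith

end Averages

/-! ### Extending actions from a semi-inner product space to a Hilbert space. -/

section Completion

/-- A continuous isometric action on a semi-inner product space extends to the completion. -/
noncomputable def IsomAction.ofSeminormed {Γ : Type u} [Group Γ] [TopologicalSpace Γ]
    {V : Type u} [SeminormedAddCommGroup V]
    [InnerProductSpace ℝ V] (a : Γ → V → V) (one_a : ∀ v, a 1 v = v)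
    (mul_a : ∀ g h v, a (g * h) v = a g (a h v))
    (dist_a : ∀ g v w, dist (a g v) (a g w) = dist v w)
    (cont_a : ∀ v, Continuous fun g => a g v) : IsomAction Γ :=
  have huc : ∀ g, UniformContinuous (a g) := fun g => (Isometry.of_dist_eq (dist_a g)).uniformContinuous
  have hcont : ∀ g, Continuous (UniformSpace.Completion.map (a g)) := fun _ =>
    UniformSpace.Completion.continuous_map
  have hdist : ∀ g (y z : UniformSpace.Completion V), dist (UniformSpace.Completion.map (a g) y)
      (UniformSpace.Completion.map (a g) z) = dist y z := fun g y z => by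
    refine UniformSpace.Completion.induction_on₂ y z (isClosed_eq ?_ continuous_dist)
      fun v w => ?_
    · exact ((hcont g).comp continuous_fst).dist ((hcont g).comp continuous_snd)
    · rw [UniformSpace.Completion.map_coe (huc g), UniformSpace.Completion.map_coe (huc g),
        UniformSpace.Completion.dist_eq, UniformSpace.Completion.dist_eq, dist_a]
  { H := UniformSpace.Completion V
    act := fun g => UniformSpace.Completion.map (a g)
    one_act := fun y => by
      refine UniformSpace.Completion.induction_on y (isClosed_eq (hcont 1) continuous_id)
        fun v => ?_
      rw [UniformSpace.Completion.map_coe (huc 1), one_a]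
    mul_act := fun g h y => by
      refine UniformSpace.Completion.induction_on y
        (isClosed_eq (hcont _) ((hcont g).comp (hcont h))) fun v => ?_
      rw [UniformSpace.Completion.map_coe (huc _), UniformSpace.Completion.map_coe (huc _),
        UniformSpace.Completion.map_coe (huc _), mul_a]
    dist_act := hdist
    continuous_act := fun y => by
      rw [continuous_iff_continuousAt]
      intro g₀
      rw [ContinuousAt, Metric.tendsto_nhds]
      intro η hη
      obtain ⟨z, ⟨v, rfl⟩, hv⟩ := Metric.mem_closure_iff.1
        (UniformSpace.Completion.denseRange_coe (α := V) y) (η / 3) (by positivity)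
      have h := Metric.tendsto_nhds.1 ((cont_a v).tendsto g₀) (η / 3) (by positivity)
      filter_upwards [h] with g hg
      have h1 : dist (UniformSpace.Completion.map (a g) (v : UniformSpace.Completion V))
          (UniformSpace.Completion.map (a g₀) (v : UniformSpace.Completion V)) < η / 3 := by
        rw [UniformSpace.Completion.map_coe (huc _), UniformSpace.Completion.map_coe (huc _),
          UniformSpace.Completion.dist_eq]
        exact hg
      have h2 := dist_triangle4 (UniformSpace.Completion.map (a g) y)
        (UniformSpace.Completion.map (a g) v) (UniformSpace.Completion.map (a g₀) v)
        (UniformSpace.Completion.map (a g₀) y)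
      rw [hdist, hdist, dist_comm (v : UniformSpace.Completion V) y] at h2
      linarith }

theorem IsomAction.exists_ofSeminormed {Γ : Type u} [Group Γ] [TopologicalSpace Γ]
    {V : Type u} [SeminormedAddCommGroup V]
    [InnerProductSpace ℝ V] (a : Γ → V → V) (one_a : ∀ v, a 1 v = v)
    (mul_a : ∀ g h v, a (g * h) v = a g (a h v))
    (dist_a : ∀ g v w, dist (a g v) (a g w) = dist v w)
    (cont_a : ∀ v, Continuous fun g => a g v) :
    ∃ (𝒜 : IsomAction Γ) (ι : V →ₗᵢ[ℝ] 𝒜.H), ∀ g v, 𝒜.act g (ι v) = ι (a g v) :=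
  ⟨IsomAction.ofSeminormed a one_a mul_a dist_a cont_a, UniformSpace.Completion.toComplₗᵢ,
    fun g v => UniformSpace.Completion.map_coe
      (Isometry.of_dist_eq (dist_a g)).uniformContinuous v⟩

end Completion

/-! ### The Banach space of continuous functions supported in a compact set. -/

section UniformContinuity

theorem eventually_forall_mem_compact_abs_sub_lt {T : Type*} {S : Type*} [TopologicalSpace T]
    [TopologicalSpace S] {G : T → S → ℝ} (hG : Continuous fun p : T × S => G p.1 p.2)
    {Q : Set S} (hQ : IsCompact Q) (t₀ : T) {η : ℝ} (hη : 0 < η) :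
    ∀ᶠ t in 𝓝 t₀, ∀ γ ∈ Q, |G t γ - G t₀ γ| < η := by
  have : CompactSpace Q := isCompact_iff_compactSpace.1 hQ
  let F : C(T × Q, ℝ) := ⟨fun p => G p.1 p.2,
    hG.comp (continuous_fst.prodMk (continuous_subtype_val.comp continuous_snd))⟩
  filter_upwards [Metric.tendsto_nhds.1 (F.curry.continuous.tendsto t₀) η hη] with t ht γ hγ
  have h := (ContinuousMap.dist_apply_le_dist (f := F.curry t) (g := F.curry t₀) ⟨γ, hγ⟩).trans_lt ht
  rwa [Real.dist_eq] at h

variable {Γ : Type u} [TopologicalSpace Γ]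

/-- The submodule of the bounded continuous functions which vanish outside `Q`. -/
noncomputable def boundedSupportedIn (Q : Set Γ) : Submodule ℝ (BoundedContinuousFunction Γ ℝ) where
  carrier := {φ | ∀ t, t ∉ Q → φ t = 0}
  add_mem' := fun hφ hχ t ht => by simp [hφ t ht, hχ t ht]
  zero_mem' := fun t _ => rfl
  smul_mem' := fun c φ hφ t ht => by simp [hφ t ht]

theorem isClosed_boundedSupportedIn (Q : Set Γ) :
    IsClosed (boundedSupportedIn Q : Set (BoundedContinuousFunction Γ ℝ)) := by
  have : (boundedSupportedIn Q : Set (BoundedContinuousFunction Γ ℝ)) =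
      ⋂ t ∈ Qᶜ, {φ | φ t = 0} := by
    ext φ
    simp only [mem_iInter, mem_compl_iff]
    exact Iff.rfl
  rw [this]
  exact isClosed_biInter fun t _ => isClosed_eq
    (BoundedContinuousFunction.evalCLM ℝ t).continuous continuous_const

/-- The Banach space of the bounded continuous functions which vanish outside `Q`. -/
def SupportedIn (Q : Set Γ) : Type u := boundedSupportedIn Q

noncomputable instance (Q : Set Γ) : NormedAddCommGroup (SupportedIn Q) :=
  inferInstanceAs (NormedAddCommGroup (boundedSupportedIn Q))

noncomputable instance (Q : Set Γ) : NormedSpace ℝ (SupportedIn Q) :=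
  inferInstanceAs (NormedSpace ℝ (boundedSupportedIn Q))

instance (Q : Set Γ) : CompleteSpace (SupportedIn Q) :=
  (isClosed_boundedSupportedIn Q).completeSpace_coe

/-- Evaluation at a point. -/
noncomputable def SupportedIn.eval (Q : Set Γ) (t : Γ) : SupportedIn Q →L[ℝ] ℝ :=
  LinearMap.mkContinuous
    { toFun := fun φ : boundedSupportedIn Q => φ.1 t
      map_add' := fun _ _ => rfl
      map_smul' := fun _ _ => rfl } 1 fun φ => by
        rw [one_mul]; exact φ.1.norm_coe_le_norm t

theorem SupportedIn.abs_eval_le {Q : Set Γ} (φ : SupportedIn Q) (t : Γ) :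
    |SupportedIn.eval Q t φ| ≤ ‖φ‖ :=
  φ.1.norm_coe_le_norm t

theorem SupportedIn.eval_eq_zero {Q : Set Γ} (φ : SupportedIn Q) {t : Γ} (ht : t ∉ Q) :
    SupportedIn.eval Q t φ = 0 :=
  φ.2 t ht

theorem SupportedIn.continuous_eval {Q : Set Γ} (φ : SupportedIn Q) :
    Continuous fun t => SupportedIn.eval Q t φ :=
  φ.1.continuous

theorem SupportedIn.dist_le {Q : Set Γ} {φ χ : SupportedIn Q} {η : ℝ} (hη : 0 ≤ η)
    (h : ∀ t, |SupportedIn.eval Q t φ - SupportedIn.eval Q t χ| ≤ η) : dist φ χ ≤ η :=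
  (BoundedContinuousFunction.dist_le hη).2 h

/-- A continuous function that vanishes outside a compact set, as a bounded function. -/
noncomputable def SupportedIn.mk {Q : Set Γ} (hQ : IsCompact Q) (φ : Γ → ℝ) (hφ : Continuous φ)
    (hφ0 : ∀ t, t ∉ Q → φ t = 0) : SupportedIn Q :=
  ⟨BoundedContinuousFunction.ofNormedAddCommGroup φ hφ
    (Classical.choose (hQ.exists_bound_of_continuousOn hφ.continuousOn) ⊔ 0) (fun t => by
      by_cases ht : t ∈ Q
      · exact (Classical.choose_spec (hQ.exists_bound_of_continuousOn hφ.continuousOn) t ht).trans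
          (le_max_left _ _)
      · rw [hφ0 t ht, norm_zero]; exact le_max_right _ _), hφ0⟩

theorem SupportedIn.eval_mk {Q : Set Γ} (hQ : IsCompact Q) (φ : Γ → ℝ) (hφ : Continuous φ)
    (hφ0 : ∀ t, t ∉ Q → φ t = 0) (t : Γ) :
    SupportedIn.eval Q t (SupportedIn.mk hQ φ hφ hφ0) = φ t := rfl

theorem SupportedIn.continuous_mk {T : Type*} [TopologicalSpace T] {Q : Set Γ} (hQ : IsCompact Q)
    (G : T → Γ → ℝ) (hG : Continuous fun p : T × Γ => G p.1 p.2)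
    (hG0 : ∀ t γ, γ ∉ Q → G t γ = 0) :
    Continuous fun t => SupportedIn.mk hQ (G t)
      (hG.comp (continuous_const.prodMk continuous_id)) (hG0 t) := by
  rw [continuous_iff_continuousAt]
  intro t₀
  rw [ContinuousAt, Metric.tendsto_nhds]
  intro η hη
  filter_upwards [eventually_forall_mem_compact_abs_sub_lt hG hQ t₀ (half_pos hη)] with t ht
  refine lt_of_le_of_lt (SupportedIn.dist_le (half_pos hη).le fun γ => ?_) (half_lt_self hη)
  rw [SupportedIn.eval_mk, SupportedIn.eval_mk]
  by_cases hγ : γ ∈ Q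
  · exact (ht γ hγ).le
  · rw [hG0 t γ hγ, hG0 t₀ γ hγ, sub_self, abs_zero]; exact (half_pos hη).le

end UniformContinuity

/-! ### Convolution as a Bochner integral. -/

section Convolution

variable {Γ : Type u} [Group Γ] [TopologicalSpace Γ] [IsTopologicalGroup Γ]
  [MeasurableSpace Γ] [BorelSpace Γ] {μ : Measure Γ} [μ.IsHaarMeasure]

/-- The convolution of `f` and `φ` is a Bochner integral of translates of `φ`. -/
theorem exists_groupConv_eq_integral {f φ : Γ → ℝ} (hf : Continuous f) (hfc : HasCompactSupport f)
    (hφ : Continuous φ) {Q : Set Γ} (hQ : IsCompact Q)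
    (hfφ : ∀ t γ, γ ∉ Q → f t * φ (t⁻¹ * γ) = 0) :
    ∃ U : Γ → SupportedIn Q, Integrable U μ ∧
      (∀ t γ, SupportedIn.eval Q γ (U t) = f t * φ (t⁻¹ * γ)) ∧
      ∀ γ, SupportedIn.eval Q γ (∫ t, U t ∂μ) = groupConv μ f φ γ := by
  have hG : Continuous fun p : Γ × Γ => f p.1 * φ (p.1⁻¹ * p.2) := by fun_prop
  have hU := SupportedIn.continuous_mk hQ (fun t γ => f t * φ (t⁻¹ * γ)) hG hfφ
  set U := fun t => SupportedIn.mk hQ (fun γ => f t * φ (t⁻¹ * γ))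
      (hG.comp (continuous_const.prodMk continuous_id)) (hfφ t) with hUdef
  have hUc : HasCompactSupport U := by
    refine HasCompactSupport.intro' hfc (isClosed_tsupport f) fun t ht => ?_
    refine dist_le_zero.1 (SupportedIn.dist_le le_rfl fun γ => ?_)
    rw [SupportedIn.eval_mk, image_eq_zero_of_notMem_tsupport ht, zero_mul, map_zero, sub_zero,
      abs_zero]
  have hint : Integrable U μ := hU.integrable_of_hasCompactSupport hUc
  exact ⟨U, hint, fun _ _ => rfl, fun γ => ((SupportedIn.eval Q γ).integral_comp_comm hint).symm⟩

end Convolution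

section AveragingConvolution

variable {Γ : Type u} [TopologicalSpace Γ] [T2Space Γ] [MeasurableSpace Γ] [BorelSpace Γ]

theorem SupportedIn.integrable {Q : Set Γ} (hQ : IsCompact Q) (μ : Measure Γ)
    [IsFiniteMeasureOnCompacts μ] (φ : SupportedIn Q) :
    Integrable (fun t => SupportedIn.eval Q t φ) μ :=
  φ.continuous_eval.integrable_of_hasCompactSupport
    (HasCompactSupport.intro hQ fun _ ht => φ.eval_eq_zero ht)

/-- Integration of the functions supported in a compact set. -/
noncomputable def SupportedIn.integral {Q : Set Γ} (hQ : IsCompact Q) (μ : Measure Γ)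
    [IsFiniteMeasureOnCompacts μ] : SupportedIn Q →L[ℝ] ℝ :=
  LinearMap.mkContinuous
    { toFun := fun φ => ∫ t, SupportedIn.eval Q t φ ∂μ
      map_add' := fun φ χ => by
        simp_rw [map_add]
        exact integral_add (φ.integrable hQ μ) (χ.integrable hQ μ)
      map_smul' := fun c φ => by
        simp_rw [map_smul]
        exact integral_const_mul _ _ } (μ.real Q) fun φ => by
    change ‖∫ t, SupportedIn.eval Q t φ ∂μ‖ ≤ _
    rw [← setIntegral_eq_integral_of_forall_compl_eq_zero (s := Q)
      fun t ht => φ.eval_eq_zero ht, mul_comm]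
    exact norm_setIntegral_le_of_norm_le_const hQ.measure_lt_top fun t _ => φ.abs_eval_le t

theorem SupportedIn.integral_apply {Q : Set Γ} (hQ : IsCompact Q) (μ : Measure Γ)
    [IsFiniteMeasureOnCompacts μ] (φ : SupportedIn Q) :
    SupportedIn.integral hQ μ φ = ∫ t, SupportedIn.eval Q t φ ∂μ := rfl

variable [Group Γ] [IsTopologicalGroup Γ] {μ : Measure Γ} [μ.IsHaarMeasure]

omit [TopologicalSpace Γ] [T2Space Γ] [MeasurableSpace Γ] [BorelSpace Γ] [IsTopologicalGroup Γ] in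
theorem mul_translate_eq_zero {f φ : Γ → ℝ} {P Q : Set Γ} (hf : ∀ t, t ∉ P → f t = 0)
    (hφ : ∀ t, t ∉ Q → φ t = 0) (t γ : Γ) (h : γ ∉ P * Q) : f t * φ (t⁻¹ * γ) = 0 := by
  by_cases ht : t ∈ P
  · rw [hφ (t⁻¹ * γ), mul_zero]
    intro h2
    exact h (by simpa using Set.mul_mem_mul ht h2)
  · rw [hf t ht, zero_mul]

/-- The total mass is found by moving the continuous functional `SupportedIn.integral` under the
Bochner integral, in place of an appeal to Fubini. -/
theorem IsAveraging.groupConv {f φ : Γ → ℝ} (hf : IsAveraging μ f) (hφ : IsAveraging μ φ) :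
    IsAveraging μ (groupConv μ f φ) := by
  have hQ : IsCompact (tsupport f * tsupport φ) := hf.hasCompactSupport.mul hφ.hasCompactSupport
  obtain ⟨U, hU, hUe, hUi⟩ := exists_groupConv_eq_integral (μ := μ) hf.continuous
    hf.hasCompactSupport hφ.continuous hQ (mul_translate_eq_zero hf.eq_zero hφ.eq_zero)
  have hfun : _root_.groupConv μ f φ = fun γ => SupportedIn.eval _ γ (∫ t, U t ∂μ) :=
    funext fun γ => (hUi γ).symm
  refine ⟨?_, fun γ => ?_, ?_, ?_⟩
  · rw [hfun]; exact SupportedIn.continuous_eval _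
  · exact integral_nonneg fun t => mul_nonneg (hf.nonneg _) (hφ.nonneg _)
  · rw [hfun]
    exact HasCompactSupport.intro hQ fun γ hγ => SupportedIn.eval_eq_zero _ hγ
  · rw [hfun, ← SupportedIn.integral_apply hQ, ← ContinuousLinearMap.integral_comp_comm _ hU]
    simp_rw [SupportedIn.integral_apply, hUe, integral_const_mul,
      integral_mul_left_eq_self φ, hφ.integral_eq_one, mul_one]
    exact hf.integral_eq_one

theorem IsAveraging.groupConvPow {f : Γ → ℝ} (hf : IsAveraging μ f) (m : ℕ) :
    IsAveraging μ (groupConvPow μ f (m + 1)) := by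
  induction m with
  | zero => exact hf
  | succ m ih => exact hf.groupConv ih

end AveragingConvolution

/-! ### Almost orbits and integrals against zero mean weights. -/

section AlmostOrbits

variable {Γ : Type u} [Group Γ] [TopologicalSpace Γ]

/-- A map defined on `K ^ n` which behaves almost like an orbit map of an isometric action. -/
structure IsAlmostOrbit (K : Set Γ) (n : ℕ) {X : Type v} [NormedAddCommGroup X] (ω : Γ → X) :
    Prop where
  continuousOn : ContinuousOn ω (K ^ n)
  norm_le : ∀ j ≤ n, ∀ γ ∈ K ^ j, ‖ω γ‖ ≤ 3 ^ j
  almost_invariant : ∀ g ∈ K ^ n, ∀ γ ∈ K ^ n, ∀ γ' ∈ K ^ n, g * γ ∈ K ^ n → g * γ' ∈ K ^ n →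
    |‖ω (g * γ) - ω (g * γ')‖ ^ 2 - ‖ω γ - ω γ'‖ ^ 2| ≤ 3 / (n + 1) * ‖ω γ - ω γ'‖ ^ 2

variable {K : Set Γ} {X : Type v} [NormedAddCommGroup X] {ω : Γ → X}

theorem IsAlmostOrbit.mono (h1 : (1 : Γ) ∈ K) {n n' : ℕ} (h : IsAlmostOrbit K n ω) (hn : n' ≤ n) :
    IsAlmostOrbit K n' ω where
  continuousOn := h.continuousOn.mono (Set.pow_subset_pow_right h1 hn)
  norm_le j hj := h.norm_le j (hj.trans hn)
  almost_invariant g hg γ hγ γ' hγ' h2 h3 := by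
    refine (h.almost_invariant g (mem_pow_of_le h1 hn hg) γ (mem_pow_of_le h1 hn hγ) γ'
      (mem_pow_of_le h1 hn hγ') (mem_pow_of_le h1 hn h2) (mem_pow_of_le h1 hn h3)).trans ?_
    gcongr

variable [IsTopologicalGroup Γ] [T2Space Γ] [MeasurableSpace Γ] [BorelSpace Γ] {μ : Measure Γ}
  [μ.IsHaarMeasure] [InnerProductSpace ℝ X]

omit [T2Space Γ] [BorelSpace Γ] [MeasurableSpace Γ]
  [InnerProductSpace ℝ X] in
theorem IsAlmostOrbit.continuousOn_translate (h1 : (1 : Γ) ∈ K) {n i j : ℕ}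
    (h : IsAlmostOrbit K n ω) {g : Γ} (hg : g ∈ K ^ i) (hij : i + j ≤ n) :
    ContinuousOn (fun t => ω (g * t)) (K ^ j) :=
  h.continuousOn.comp (continuous_const_mul g).continuousOn fun _ ht =>
    mem_pow_of_le h1 hij (mul_mem_pow_add hg ht)

theorem IsAlmostOrbit.integrable_smul (hKc : IsCompact K) (h1 : (1 : Γ) ∈ K) {n j : ℕ}
    (h : IsAlmostOrbit K n ω) (hj : j ≤ n) {φ : Γ → ℝ} (hφ : Continuous φ)
    (hφ0 : ∀ t, t ∉ K ^ j → φ t = 0) : Integrable (fun t => φ t • ω t) μ :=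
  integrable_smul_of_continuousOn (isCompact_pow hKc j) hφ hφ0
    (h.continuousOn.mono (Set.pow_subset_pow_right h1 hj))

omit [T2Space Γ] [BorelSpace Γ] in
theorem IsAlmostOrbit.norm_integral_le (hKc : IsCompact K) {n j : ℕ}
    (h : IsAlmostOrbit K n ω) (hj : j ≤ n) {φ : Γ → ℝ}
    (hφ0 : ∀ t, t ∉ K ^ j → φ t = 0) {a : ℝ} (hφa : ∀ t, |φ t| ≤ a) :
    ‖∫ t, φ t • ω t ∂μ‖ ≤ 3 ^ j * μ.real (K ^ j) * a := by
  have hc := isCompact_pow hKc j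
  rw [← setIntegral_eq_integral_of_forall_compl_eq_zero (s := K ^ j)
      fun t ht => by rw [hφ0 t ht, zero_smul]]
  refine (norm_setIntegral_le_of_norm_le_const (C := 3 ^ j * a) hc.measure_lt_top
    fun t ht => ?_).trans (le_of_eq (by ring))
  rw [norm_smul, mul_comm]
  exact mul_le_mul (h.norm_le j hj t ht) (hφa t) (abs_nonneg _) (by positivity)

/-- For a weight `v` of mass zero, `-2 * ‖∫ v • F‖ ^ 2` is the double integral of `v s * v t * ‖F t
- F s‖ ^ 2`, so nearly equal pairwise distances give nearly equal norms. -/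
theorem abs_norm_sq_sub_norm_sq_le [CompleteSpace X] {F F' : Γ → X} {v : Γ → ℝ} {Q : Set Γ}
    (hQ : IsCompact Q) (hv : Continuous v) (hv0 : ∀ t, t ∉ Q → v t = 0) (hvi : ∫ t, v t ∂μ = 0)
    (hF : ContinuousOn F Q) (hF' : ContinuousOn F' Q) {η : ℝ}
    (hη : ∀ s ∈ Q, ∀ t ∈ Q, |‖F' t - F' s‖ ^ 2 - ‖F t - F s‖ ^ 2| ≤ η) :
    |‖∫ t, v t • F' t ∂μ‖ ^ 2 - ‖∫ t, v t • F t ∂μ‖ ^ 2| ≤ (∫ t, |v t| ∂μ) ^ 2 * η := by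
  have hvint : Integrable v μ :=
    hv.integrable_of_hasCompactSupport (HasCompactSupport.intro hQ hv0)
  have hFi := integrable_smul_of_continuousOn (μ := μ) hQ hv hv0 hF
  have hFi' := integrable_smul_of_continuousOn (μ := μ) hQ hv hv0 hF'
  have hFq := integrable_smul_of_continuousOn (μ := μ) hQ hv hv0 (hF.norm.pow 2)
  have hFq' := integrable_smul_of_continuousOn (μ := μ) hQ hv hv0 (hF'.norm.pow 2)
  have e := integral_weight_double hvint hFi hFq
  have e' := integral_weight_double hvint hFi' hFq'
  rw [hvi, zero_mul, zero_sub] at e e'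
  have hη' : ∀ s, |v s * ∫ t, v t * ‖F' t - F' s‖ ^ 2 ∂μ - v s * ∫ t, v t * ‖F t - F s‖ ^ 2 ∂μ| ≤
      |v s| * ((∫ t, |v t| ∂μ) * η) := by
    intro s
    by_cases hs : s ∈ Q
    · rw [← mul_sub, abs_mul]
      refine mul_le_mul_of_nonneg_left ?_ (abs_nonneg _)
      rw [← integral_sub (integrable_weight_norm_sub_sq hvint hFi' hFq' _)
        (integrable_weight_norm_sub_sq hvint hFi hFq _), ← integral_mul_const]
      refine (Real.norm_eq_abs _).symm.trans_le (norm_integral_le_of_norm_le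
        (hvint.abs.mul_const _) (Filter.Eventually.of_forall fun t => ?_))
      rw [← mul_sub, Real.norm_eq_abs, abs_mul]
      by_cases ht : t ∈ Q
      · exact mul_le_mul_of_nonneg_left (hη s hs t ht) (abs_nonneg _)
      · simp [hv0 t ht]
    · simp [hv0 s hs]
  have h := norm_integral_le_of_norm_le (f := fun s => v s * ∫ t, v t * ‖F' t - F' s‖ ^ 2 ∂μ -
    v s * ∫ t, v t * ‖F t - F s‖ ^ 2 ∂μ) (hvint.abs.mul_const ((∫ t, |v t| ∂μ) * η))
    (Filter.Eventually.of_forall hη')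
  rw [integral_sub (integrable_weight_double hvint hFi' hFq')
    (integrable_weight_double hvint hFi hFq), e, e', integral_mul_const, Real.norm_eq_abs] at h
  have h2 : 2 * -‖∫ t, v t • F' t ∂μ‖ ^ 2 - 2 * -‖∫ t, v t • F t ∂μ‖ ^ 2 =
      -2 * (‖∫ t, v t • F' t ∂μ‖ ^ 2 - ‖∫ t, v t • F t ∂μ‖ ^ 2) := by ring
  rw [h2, abs_mul] at h
  norm_num at h
  nlinarith [abs_nonneg (‖∫ t, v t • F' t ∂μ‖ ^ 2 - ‖∫ t, v t • F t ∂μ‖ ^ 2)]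

/-- Translating the weight amounts to translating the orbit, which changes pairwise distances
little. The bound tends to zero as `n` grows with `v` fixed. -/
theorem IsAlmostOrbit.abs_norm_translate_sq_sub_le [CompleteSpace X] (hKc : IsCompact K)
    (h1 : (1 : Γ) ∈ K) {n i j : ℕ} (h : IsAlmostOrbit K n ω) {g : Γ} (hg : g ∈ K ^ i)
    (hij : i + j ≤ n) {v : Γ → ℝ} (hv : Continuous v) (hv0 : ∀ t, t ∉ K ^ j → v t = 0)
    (hvi : ∫ t, v t ∂μ = 0) :
    |‖∫ t, v (g⁻¹ * t) • ω t ∂μ‖ ^ 2 - ‖∫ t, v t • ω t ∂μ‖ ^ 2| ≤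
      (∫ t, |v t| ∂μ) ^ 2 * (3 / (n + 1) * (2 * 3 ^ j) ^ 2) := by
  have hj : j ≤ n := le_trans (Nat.le_add_left _ _) hij
  have e : ∫ t, v (g⁻¹ * t) • ω t ∂μ = ∫ t, v t • ω (g * t) ∂μ := by
    rw [← integral_mul_left_eq_self (fun t => v (g⁻¹ * t) • ω t) g]
    simp
  rw [e]
  refine abs_norm_sq_sub_norm_sq_le (isCompact_pow hKc j) hv hv0 hvi
    (h.continuousOn.mono (Set.pow_subset_pow_right h1 hj))
    (h.continuousOn_translate h1 hg hij) fun s hs t ht => ?_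
  refine (h.almost_invariant g (mem_pow_of_le h1 ((Nat.le_add_right _ _).trans hij) hg)
    t (mem_pow_of_le h1 hj ht) s (mem_pow_of_le h1 hj hs)
    (mem_pow_of_le h1 hij (mul_mem_pow_add hg ht))
    (mem_pow_of_le h1 hij (mul_mem_pow_add hg hs))).trans ?_
  have h3 : ‖ω t - ω s‖ ≤ 2 * 3 ^ j :=
    (norm_sub_le _ _).trans (by linarith [h.norm_le j hj t ht, h.norm_le j hj s hs])
  gcongr

end AlmostOrbits

/-! ### Test functions and left translation. -/

section TestFunctions

variable {Γ : Type u} [Group Γ] [TopologicalSpace Γ]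

/-- Continuous functions vanishing outside some power of `K`. -/
structure IsTestFunction (K : Set Γ) (φ : Γ → ℝ) : Prop where
  continuous : Continuous φ
  exists_support : ∃ j, ∀ t, t ∉ K ^ j → φ t = 0

variable {K : Set Γ} {φ χ : Γ → ℝ}

theorem IsTestFunction.add (h1 : (1 : Γ) ∈ K) (hφ : IsTestFunction K φ) (hχ : IsTestFunction K χ) :
    IsTestFunction K (φ + χ) := by
  obtain ⟨i, hi⟩ := hφ.exists_support
  obtain ⟨j, hj⟩ := hχ.exists_support
  refine ⟨hφ.continuous.add hχ.continuous, max i j, fun t ht => ?_⟩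
  rw [Pi.add_apply, hi t fun h => ht (mem_pow_of_le h1 (le_max_left _ _) h),
    hj t fun h => ht (mem_pow_of_le h1 (le_max_right _ _) h), add_zero]

theorem IsTestFunction.smul (c : ℝ) (hφ : IsTestFunction K φ) : IsTestFunction K (c • φ) := by
  obtain ⟨i, hi⟩ := hφ.exists_support
  exact ⟨hφ.continuous.const_smul c, i, fun t ht => by rw [Pi.smul_apply, hi t ht, smul_zero]⟩

theorem IsTestFunction.sub (h1 : (1 : Γ) ∈ K) (hφ : IsTestFunction K φ) (hχ : IsTestFunction K χ) :
    IsTestFunction K (φ - χ) := by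
  have := hφ.add h1 (hχ.smul (-1))
  rwa [neg_one_smul, ← sub_eq_add_neg] at this

/-- Left translation of functions. -/
def leftTranslate (g : Γ) (φ : Γ → ℝ) : Γ → ℝ := fun t => φ (g⁻¹ * t)

omit [TopologicalSpace Γ] in
theorem leftTranslate_one (φ : Γ → ℝ) : leftTranslate 1 φ = φ := by
  funext t; simp [leftTranslate]

omit [TopologicalSpace Γ] in
theorem leftTranslate_mul (g h : Γ) (φ : Γ → ℝ) :
    leftTranslate (g * h) φ = leftTranslate g (leftTranslate h φ) := by
  funext t; simp [leftTranslate, mul_assoc]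

omit [TopologicalSpace Γ] in
theorem leftTranslate_sub (g : Γ) (φ χ : Γ → ℝ) :
    leftTranslate g (φ - χ) = leftTranslate g φ - leftTranslate g χ := rfl

omit [TopologicalSpace Γ] in
theorem leftTranslate_eq_zero {g : Γ} {i j : ℕ} (hg : g ∈ K ^ i)
    (hφ : ∀ t, t ∉ K ^ j → φ t = 0) (t : Γ) (ht : t ∉ K ^ (i + j)) : leftTranslate g φ t = 0 := by
  refine hφ _ fun h => ht ?_
  simpa using mul_mem_pow_add hg h

variable [IsTopologicalGroup Γ]

theorem IsTestFunction.leftTranslate (hgen : ∀ γ : Γ, ∃ n : ℕ, γ ∈ K ^ n) (g : Γ)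
    (hφ : IsTestFunction K φ) : IsTestFunction K (leftTranslate g φ) := by
  obtain ⟨i, hi⟩ := hgen g
  obtain ⟨j, hj⟩ := hφ.exists_support
  exact ⟨hφ.continuous.comp (continuous_const_mul _), i + j, leftTranslate_eq_zero hi hj⟩

theorem IsTestFunction.integrable [T2Space Γ] [MeasurableSpace Γ] [BorelSpace Γ] {μ : Measure Γ}
    [μ.IsHaarMeasure] (hKc : IsCompact K) (hφ : IsTestFunction K φ) : Integrable φ μ := by
  obtain ⟨j, hj⟩ := hφ.exists_support
  exact hφ.continuous.integrable_of_hasCompactSupport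
    (HasCompactSupport.intro (isCompact_pow hKc j) hj)

theorem IsTestFunction.exists_bound (hKc : IsCompact K) (hφ : IsTestFunction K φ) :
    ∃ a, 0 ≤ a ∧ ∀ t, |φ t| ≤ a := by
  obtain ⟨j, hj⟩ := hφ.exists_support
  obtain ⟨a, ha⟩ := (isCompact_pow hKc j).exists_bound_of_continuousOn hφ.continuous.continuousOn
  refine ⟨max a 0, le_max_right _ _, fun t => ?_⟩
  by_cases ht : t ∈ K ^ j
  · exact (ha t ht).trans (le_max_left _ _)
  · rw [hj t ht, abs_zero]; exact le_max_right _ _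

theorem IsAveraging.isTestFunction [MeasurableSpace Γ] {μ : Measure Γ}
    (hK : K ∈ 𝓝 (1 : Γ)) (hgen : ∀ γ : Γ, ∃ n : ℕ, γ ∈ K ^ n) (hφ : IsAveraging μ φ) :
    IsTestFunction K φ := by
  obtain ⟨j, hj⟩ := exists_subset_pow hK hgen hφ.hasCompactSupport
  exact ⟨hφ.continuous, j, fun t ht => hφ.eq_zero t fun h => ht (hj h)⟩

end TestFunctions

/-! ### The ultralimit of a sequence of almost orbits. -/

section Ultralimits

theorem tendsto_limUnder_hyperfilter {a : ℕ → ℝ} {c : ℝ} (h : ∀ᶠ n in Filter.atTop, |a n| ≤ c) :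
    Filter.Tendsto a (Filter.hyperfilter ℕ) (𝓝 (Filter.limUnder (Filter.hyperfilter ℕ : Filter ℕ) a)) := by
  refine tendsto_nhds_limUnder ?_
  have h1 : ∀ᶠ n in (Filter.hyperfilter ℕ : Filter ℕ), a n ∈ Icc (-c) c :=
    (h.filter_mono Nat.hyperfilter_le_atTop).mono fun n hn => abs_le.1 hn
  obtain ⟨x, _, hx⟩ := (isCompact_Icc (a := -c) (b := c)).ultrafilter_le_nhds'
    ((Filter.hyperfilter ℕ).map a) h1
  exact ⟨x, hx⟩

end Ultralimits

/-- A sequence of almost orbits in Hilbert spaces which become better and better. -/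
structure AlmostOrbitSequence {Γ : Type u} [Group Γ] [TopologicalSpace Γ] [MeasurableSpace Γ]
    (μ : Measure Γ) (K : Set Γ) where
  X : ℕ → Type v
  [normedX : ∀ n, NormedAddCommGroup (X n)]
  [innerX : ∀ n, InnerProductSpace ℝ (X n)]
  [completeX : ∀ n, CompleteSpace (X n)]
  ω : ∀ n, Γ → X n
  isAlmostOrbit : ∀ n, IsAlmostOrbit K n (ω n)
  isCompact : IsCompact K
  mem_nhds : K ∈ 𝓝 (1 : Γ)
  generates : ∀ γ : Γ, ∃ n : ℕ, γ ∈ K ^ n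

attribute [instance] AlmostOrbitSequence.normedX AlmostOrbitSequence.innerX
  AlmostOrbitSequence.completeX

namespace AlmostOrbitSequence

variable {Γ : Type u} [Group Γ] [TopologicalSpace Γ] [IsTopologicalGroup Γ] [T2Space Γ]
  [MeasurableSpace Γ] [BorelSpace Γ] {μ : Measure Γ} [μ.IsHaarMeasure] {K : Set Γ}
  (S : AlmostOrbitSequence.{u, v} μ K)

omit [IsTopologicalGroup Γ] [T2Space Γ] [BorelSpace Γ] [μ.IsHaarMeasure] in
theorem one_mem (S : AlmostOrbitSequence.{u, v} μ K) : (1 : Γ) ∈ K := mem_of_mem_nhds S.mem_nhds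

/-- The `φ`-weighted integral of the `n`-th almost orbit. -/
noncomputable def smear (n : ℕ) (φ : Γ → ℝ) : S.X n := ∫ t, φ t • S.ω n t ∂μ

theorem eventually_integrable {φ : Γ → ℝ} (hφ : IsTestFunction K φ) :
    ∀ᶠ n in Filter.atTop, Integrable (fun t => φ t • S.ω n t) μ := by
  obtain ⟨j, hj⟩ := hφ.exists_support
  filter_upwards [Filter.eventually_ge_atTop j] with n hn
  exact (S.isAlmostOrbit n).integrable_smul S.isCompact S.one_mem hn hφ.continuous hj

theorem eventually_smear_add {φ χ : Γ → ℝ} (hφ : IsTestFunction K φ) (hχ : IsTestFunction K χ) :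
    ∀ᶠ n in Filter.atTop, S.smear n (φ + χ) = S.smear n φ + S.smear n χ := by
  filter_upwards [S.eventually_integrable hφ, S.eventually_integrable hχ] with n h1 h2
  unfold smear
  rw [← integral_add h1 h2]
  simp_rw [Pi.add_apply, add_smul]

omit [IsTopologicalGroup Γ] [T2Space Γ] [BorelSpace Γ] [μ.IsHaarMeasure] in
theorem smear_smul (n : ℕ) (c : ℝ) (φ : Γ → ℝ) : S.smear n (c • φ) = c • S.smear n φ := by
  unfold smear
  rw [← integral_smul]
  simp_rw [Pi.smul_apply, smul_assoc]

omit [T2Space Γ] [BorelSpace Γ] in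
theorem norm_smear_le {n j : ℕ} (hj : j ≤ n) {φ : Γ → ℝ} (hφ0 : ∀ t, t ∉ K ^ j → φ t = 0) {a : ℝ}
    (hφa : ∀ t, |φ t| ≤ a) : ‖S.smear n φ‖ ≤ 3 ^ j * μ.real (K ^ j) * a :=
  (S.isAlmostOrbit n).norm_integral_le S.isCompact hj hφ0 hφa

omit [T2Space Γ] [BorelSpace Γ] in
theorem exists_norm_smear_le {φ : Γ → ℝ} (hφ : IsTestFunction K φ) :
    ∃ c, ∀ᶠ n in Filter.atTop, ‖S.smear n φ‖ ≤ c := by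
  obtain ⟨j, hj⟩ := hφ.exists_support
  obtain ⟨a, _, ha⟩ := hφ.exists_bound S.isCompact
  exact ⟨_, (Filter.eventually_ge_atTop j).mono fun n hn => S.norm_smear_le hn hj ha⟩

/-- The ultralimit of the inner products of the weighted integrals. -/
noncomputable def form (φ χ : Γ → ℝ) : ℝ :=
  Filter.limUnder (Filter.hyperfilter ℕ : Filter ℕ)
    (fun n => inner ℝ (S.smear n φ) (S.smear n χ))

omit [T2Space Γ] [BorelSpace Γ] in
theorem tendsto_form {φ χ : Γ → ℝ} (hφ : IsTestFunction K φ) (hχ : IsTestFunction K χ) :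
    Filter.Tendsto (fun n => inner ℝ (S.smear n φ) (S.smear n χ)) (Filter.hyperfilter ℕ)
      (𝓝 (S.form φ χ)) := by
  obtain ⟨a, ha⟩ := S.exists_norm_smear_le hφ
  obtain ⟨b, hb⟩ := S.exists_norm_smear_le hχ
  refine tendsto_limUnder_hyperfilter (c := a * b) ?_
  filter_upwards [ha, hb] with n h1 h2
  exact (abs_real_inner_le_norm _ _).trans
    (mul_le_mul h1 h2 (norm_nonneg _) ((norm_nonneg _).trans h1))

/-- The test functions of integral zero. -/
def zeroMean : Submodule ℝ (Γ → ℝ) where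
  carrier := {φ | IsTestFunction K φ ∧ ∫ t, φ t ∂μ = 0}
  add_mem' := fun {φ χ} hφ hχ => by
    refine ⟨hφ.1.add S.one_mem hχ.1, ?_⟩
    have := integral_add (hφ.1.integrable (μ := μ) S.isCompact) (hχ.1.integrable S.isCompact)
    simp only [Pi.add_apply, this, hφ.2, hχ.2, add_zero]
  zero_mem' := ⟨⟨continuous_const, 0, fun _ _ => rfl⟩, by simp⟩
  smul_mem' := fun c φ hφ => ⟨hφ.1.smul c, by simp [integral_const_mul, hφ.2]⟩

/-- The semi-inner product space of test functions of integral zero. -/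
def Space : Type u := S.zeroMean

noncomputable instance : AddCommGroup S.Space := inferInstanceAs (AddCommGroup S.zeroMean)

noncomputable instance : Module ℝ S.Space := inferInstanceAs (Module ℝ S.zeroMean)

/-- The function underlying an element of the limit space. -/
def Space.toFun {S : AlmostOrbitSequence.{u, v} μ K} (φ : S.Space) : Γ → ℝ := φ.1

variable {S}

theorem Space.ext {φ χ : S.Space} (h : φ.toFun = χ.toFun) : φ = χ := Subtype.ext h

theorem Space.toFun_add (φ χ : S.Space) : (φ + χ).toFun = φ.toFun + χ.toFun := rfl

theorem Space.toFun_sub (φ χ : S.Space) : (φ - χ).toFun = φ.toFun - χ.toFun := rfl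

theorem Space.toFun_smul (c : ℝ) (φ : S.Space) : (c • φ).toFun = c • φ.toFun := rfl

theorem Space.isTestFunction (φ : S.Space) : IsTestFunction K φ.toFun := φ.2.1

theorem Space.integral_eq_zero (φ : S.Space) : ∫ t, φ.toFun t ∂μ = 0 := φ.2.2

/-- The element of the limit space given by a test function of integral zero. -/
def Space.mk (φ : Γ → ℝ) (hφ : IsTestFunction K φ) (hi : ∫ t, φ t ∂μ = 0) : S.Space :=
  ⟨φ, hφ, hi⟩

theorem Space.toFun_mk (φ : Γ → ℝ) (hφ : IsTestFunction K φ) (hi : ∫ t, φ t ∂μ = 0) :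
    (Space.mk φ hφ hi : S.Space).toFun = φ := rfl

variable (S)

/-- The semi-inner product on the limit space. -/
noncomputable abbrev core : PreInnerProductSpace.Core ℝ S.Space where
  inner φ χ := S.form φ.toFun χ.toFun
  conj_inner_symm φ χ := by
    simp only [conj_trivial]
    refine tendsto_nhds_unique (S.tendsto_form χ.isTestFunction φ.isTestFunction) ?_
    simp_rw [real_inner_comm (S.smear _ φ.toFun)]
    exact S.tendsto_form φ.isTestFunction χ.isTestFunction
  re_inner_nonneg φ :=
    ge_of_tendsto (S.tendsto_form φ.isTestFunction φ.isTestFunction)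
      (Filter.Eventually.of_forall fun _ => real_inner_self_nonneg)
  add_left φ χ ψ := by
    refine tendsto_nhds_unique (S.tendsto_form (φ + χ).isTestFunction ψ.isTestFunction) ?_
    refine ((S.tendsto_form φ.isTestFunction ψ.isTestFunction).add
      (S.tendsto_form χ.isTestFunction ψ.isTestFunction)).congr' ?_
    filter_upwards [(S.eventually_smear_add φ.isTestFunction χ.isTestFunction).filter_mono
      Nat.hyperfilter_le_atTop] with n hn
    rw [Space.toFun_add, hn, inner_add_left]
  smul_left φ χ c := by
    refine tendsto_nhds_unique (S.tendsto_form (c • φ).isTestFunction χ.isTestFunction) ?_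
    refine ((S.tendsto_form φ.isTestFunction χ.isTestFunction).const_mul c).congr fun n => ?_
    rw [Space.toFun_smul, smear_smul, real_inner_smul_left]

noncomputable instance : SeminormedAddCommGroup S.Space :=
  InnerProductSpace.Core.toSeminormedAddCommGroup (c := S.core)

noncomputable instance : InnerProductSpace ℝ S.Space := InnerProductSpace.ofCore S.core

variable {S}

theorem Space.norm_sq (φ : S.Space) : ‖φ‖ ^ 2 = S.form φ.toFun φ.toFun :=
  (real_inner_self_eq_norm_sq φ).symm

theorem Space.tendsto_norm (φ : S.Space) :
    Filter.Tendsto (fun n => ‖S.smear n φ.toFun‖) (Filter.hyperfilter ℕ) (𝓝 ‖φ‖) := by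
  have h := (S.tendsto_form φ.isTestFunction φ.isTestFunction).sqrt
  rw [← Space.norm_sq, Real.sqrt_sq (norm_nonneg _)] at h
  refine h.congr fun n => ?_
  rw [real_inner_self_eq_norm_sq, Real.sqrt_sq (norm_nonneg _)]

theorem Space.norm_le {j : ℕ} (φ : S.Space) (hφ0 : ∀ t, t ∉ K ^ j → φ.toFun t = 0) {a : ℝ}
    (hφa : ∀ t, |φ.toFun t| ≤ a) : ‖φ‖ ≤ 3 ^ j * μ.real (K ^ j) * a := by
  refine le_of_tendsto φ.tendsto_norm ?_
  filter_upwards [(Filter.eventually_ge_atTop j).filter_mono Nat.hyperfilter_le_atTop] with n hn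
  exact S.norm_smear_le hn hφ0 hφa

/-- Left translation on the limit space. -/
def Space.translate (g : Γ) (φ : S.Space) : S.Space :=
  Space.mk (leftTranslate g φ.toFun) (φ.isTestFunction.leftTranslate S.generates g) (by
    unfold leftTranslate
    rw [integral_mul_left_eq_self φ.toFun, φ.integral_eq_zero])

/-- Zero mean is essential here: it makes the norms depend only on pairwise distances in the almost
orbits, whose distortion vanishes in the limit. -/
theorem Space.norm_translate (g : Γ) (φ : S.Space) : ‖Space.translate g φ‖ = ‖φ‖ := by
  rw [← sq_eq_sq₀ (norm_nonneg _) (norm_nonneg _)]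
  obtain ⟨i, hi⟩ := S.generates g
  obtain ⟨j, hj⟩ := φ.isTestFunction.exists_support
  have h1 := ((Space.translate g φ).tendsto_norm.pow 2).sub (φ.tendsto_norm.pow 2)
  have h2 : Filter.Tendsto (fun n : ℕ => (∫ t, |φ.toFun t| ∂μ) ^ 2 *
      (3 / ((n : ℝ) + 1) * (2 * 3 ^ j) ^ 2)) Filter.atTop (𝓝 0) := by
    have h3 : Filter.Tendsto (fun n : ℕ => 3 / ((n : ℝ) + 1)) Filter.atTop (𝓝 0) := by
      have := (tendsto_one_div_add_atTop_nhds_zero_nat (𝕜 := ℝ)).const_mul 3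
      simpa [div_eq_mul_inv] using this
    simpa using (h3.mul_const ((2 * 3 ^ j) ^ 2)).const_mul ((∫ t, |φ.toFun t| ∂μ) ^ 2)
  have h4 := squeeze_zero_norm' (f := fun n => ‖S.smear n (Space.translate g φ).toFun‖ ^ 2 -
      ‖S.smear n φ.toFun‖ ^ 2) ?_ (h2.mono_left Nat.hyperfilter_le_atTop)
  · exact sub_eq_zero.1 (tendsto_nhds_unique h1 h4)
  · filter_upwards [(Filter.eventually_ge_atTop (i + j)).filter_mono
      Nat.hyperfilter_le_atTop] with n hn
    exact (S.isAlmostOrbit n).abs_norm_translate_sq_sub_le S.isCompact S.one_mem hi hn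
      φ.isTestFunction.continuous hj φ.integral_eq_zero

end AlmostOrbitSequence

namespace AlmostOrbitSequence

variable {Γ : Type u} [Group Γ] [TopologicalSpace Γ] [IsTopologicalGroup Γ] [T2Space Γ]
  [MeasurableSpace Γ] [BorelSpace Γ] {μ : Measure Γ} [μ.IsHaarMeasure] {K : Set Γ}
  (S : AlmostOrbitSequence.{u, v} μ K) {f : Γ → ℝ}

/-- The element `φ - f` of the limit space, for averaging functions `φ` and `f`. -/
def Space.ofAveraging (hf : IsAveraging μ f) {φ : Γ → ℝ} (hφ : IsAveraging μ φ) : S.Space :=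
  Space.mk (φ - f) ((hφ.isTestFunction S.mem_nhds S.generates).sub S.one_mem
    (hf.isTestFunction S.mem_nhds S.generates)) (by
      simp only [Pi.sub_apply]
      rw [integral_sub hφ.integrable hf.integrable, hφ.integral_eq_one, hf.integral_eq_one,
        sub_self])

variable {S}

theorem Space.isTestFunction_add (hf : IsAveraging μ f) (φ : S.Space) :
    IsTestFunction K (φ.toFun + f) :=
  φ.isTestFunction.add S.one_mem (hf.isTestFunction S.mem_nhds S.generates)

/-- The affine action on the limit space for which `g` maps `φ` to `g(φ + f) - f`. -/
def Space.affine (hf : IsAveraging μ f) (g : Γ) (φ : S.Space) : S.Space :=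
  Space.mk (leftTranslate g (φ.toFun + f) - f)
    (((φ.isTestFunction_add hf).leftTranslate S.generates g).sub S.one_mem
      (hf.isTestFunction S.mem_nhds S.generates)) (by
      have h1 : Integrable (φ.toFun + f) μ := (φ.isTestFunction_add hf).integrable S.isCompact
      have h2 : Integrable (leftTranslate g (φ.toFun + f)) μ := h1.comp_mul_left g⁻¹
      simp only [Pi.sub_apply]
      rw [integral_sub h2 hf.integrable]
      unfold leftTranslate
      rw [integral_mul_left_eq_self (φ.toFun + f)]
      simp only [Pi.add_apply]
      rw [integral_add (φ.isTestFunction.integrable S.isCompact) hf.integrable,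
        φ.integral_eq_zero, zero_add, sub_self])

theorem Space.toFun_affine (hf : IsAveraging μ f) (g : Γ) (φ : S.Space) :
    (Space.affine hf g φ).toFun = leftTranslate g (φ.toFun + f) - f := rfl

theorem Space.dist_affine (hf : IsAveraging μ f) (g : Γ) (φ χ : S.Space) :
    dist (Space.affine hf g φ) (Space.affine hf g χ) = dist φ χ := by
  rw [dist_eq_norm, dist_eq_norm, ← Space.norm_translate g (φ - χ)]
  congr 1
  refine Space.ext ?_
  rw [Space.toFun_sub, Space.toFun_affine, Space.toFun_affine, sub_sub_sub_cancel_right,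
    ← leftTranslate_sub, add_sub_add_right_eq_sub]
  rfl

/-- For `g` near `g₀` the two translates have supports in a common power of `K` and are uniformly
close; there the sup norm dominates the limit seminorm. -/
theorem Space.continuous_affine (hf : IsAveraging μ f) (φ : S.Space) :
    Continuous fun g => Space.affine hf g φ := by
  rw [continuous_iff_continuousAt]
  intro g₀
  rw [ContinuousAt, Metric.tendsto_nhds]
  intro η hη
  obtain ⟨i, hi⟩ := S.generates g₀
  have hφ := φ.isTestFunction_add hf
  obtain ⟨j, hj⟩ := hφ.exists_support
  set C : ℝ := 3 ^ (i + 1 + j) * μ.real (K ^ (i + 1 + j)) with hC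
  have hC0 : 0 ≤ C := by positivity
  have hη' : 0 < η / (C + 1) := by positivity
  have hG : Continuous fun p : Γ × Γ => leftTranslate p.1 (φ.toFun + f) p.2 :=
    hφ.continuous.comp (by fun_prop)
  filter_upwards [pow_succ_mem_nhds S.mem_nhds hi, eventually_forall_mem_compact_abs_sub_lt
    (G := fun g => leftTranslate g (φ.toFun + f)) hG
    (isCompact_pow S.isCompact (i + 1 + j)) g₀ hη'] with g hg hlt
  have hfun : (Space.affine hf g φ - Space.affine hf g₀ φ).toFun =
      leftTranslate g (φ.toFun + f) - leftTranslate g₀ (φ.toFun + f) := by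
    rw [Space.toFun_sub, Space.toFun_affine, Space.toFun_affine, sub_sub_sub_cancel_right]
  have hzero : ∀ t, t ∉ K ^ (i + 1 + j) →
      (Space.affine hf g φ - Space.affine hf g₀ φ).toFun t = 0 := fun t ht => by
    rw [hfun, Pi.sub_apply, leftTranslate_eq_zero hg hj t ht,
      leftTranslate_eq_zero (mem_pow_of_le S.one_mem (Nat.le_succ i) hi) hj t ht, sub_self]
  rw [dist_eq_norm]
  refine (Space.norm_le _ hzero (a := η / (C + 1)) fun t => ?_).trans_lt ?_
  · by_cases ht : t ∈ K ^ (i + 1 + j)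
    · rw [hfun]; exact (hlt t ht).le
    · rw [hzero t ht, abs_zero]; exact hη'.le
  · rw [← hC, mul_div_assoc', div_lt_iff₀ (by positivity)]
    nlinarith

/-- The linear map from functions supported in a compact set to the limit space which subtracts
the multiple of `f` of the same integral. -/
noncomputable def Space.ofSupported (hf : IsAveraging μ f) (J : ℕ) : SupportedIn (K ^ J) →ₗ[ℝ] S.Space where
  toFun ψ := Space.mk ((fun t => SupportedIn.eval _ t ψ) -
      (SupportedIn.integral (isCompact_pow S.isCompact J) μ ψ) • f)
    (IsTestFunction.sub S.one_mem ⟨ψ.continuous_eval, J, fun t ht => ψ.eval_eq_zero ht⟩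
      ((hf.isTestFunction S.mem_nhds S.generates).smul _)) (by
      simp only [Pi.sub_apply, Pi.smul_apply, smul_eq_mul]
      rw [integral_sub (ψ.integrable (isCompact_pow S.isCompact J) μ)
        (hf.integrable.const_mul _), integral_const_mul, hf.integral_eq_one, mul_one,
        SupportedIn.integral_apply, sub_self])
  map_add' ψ χ := by
    refine Space.ext ?_
    funext t
    simp only [Space.toFun_add, Space.toFun_mk, Pi.add_apply, Pi.sub_apply, Pi.smul_apply,
      smul_eq_mul, map_add]
    ring
  map_smul' c ψ := by
    refine Space.ext ?_
    funext t
    simp only [Space.toFun_smul, Space.toFun_mk, Pi.sub_apply, Pi.smul_apply,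
      smul_eq_mul, map_smul, RingHom.id_apply]
    ring

theorem Space.toFun_ofSupported (hf : IsAveraging μ f) (J : ℕ) (ψ : SupportedIn (K ^ J)) :
    (Space.ofSupported hf J ψ : S.Space).toFun = (fun t => SupportedIn.eval _ t ψ) -
      (SupportedIn.integral (isCompact_pow S.isCompact J) μ ψ) • f := rfl

/-- This boundedness allows the map to be exchanged with Bochner integrals. -/
theorem Space.exists_norm_ofSupported_le (hf : IsAveraging μ f) {J : ℕ}
    (hJ : ∀ t, t ∉ K ^ J → f t = 0) :
    ∃ C, ∀ ψ : SupportedIn (K ^ J), ‖(Space.ofSupported hf J ψ : S.Space)‖ ≤ C * ‖ψ‖ := by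
  obtain ⟨a, ha0, ha⟩ := (hf.isTestFunction S.mem_nhds S.generates).exists_bound S.isCompact
  set I := SupportedIn.integral (isCompact_pow S.isCompact J) μ
  refine ⟨3 ^ J * μ.real (K ^ J) * (1 + ‖I‖ * a), fun ψ => ?_⟩
  refine (Space.norm_le _ (j := J) (a := (1 + ‖I‖ * a) * ‖ψ‖) (fun t ht => ?_) fun t => ?_).trans
    (le_of_eq (by ring))
  · rw [Space.toFun_ofSupported, Pi.sub_apply, Pi.smul_apply, ψ.eval_eq_zero ht, hJ t ht,
      smul_zero, sub_self]
  · rw [Space.toFun_ofSupported, Pi.sub_apply, Pi.smul_apply, smul_eq_mul]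
    refine (abs_sub _ _).trans ?_
    rw [abs_mul]
    have h1 := ψ.abs_eval_le t
    have h2 : |I ψ| * |f t| ≤ ‖I‖ * ‖ψ‖ * a :=
      mul_le_mul (I.le_opNorm ψ) (ha t) (abs_nonneg _) (by positivity)
    linarith

/-- The element `t` sends `φ - f` to the translate of `φ` by `t`, minus `f`; integrating against `f
t` gives the convolution of `f` and `φ`, minus `f`. -/
theorem avg_ofAveraging (hf : IsAveraging μ f) {φ : Γ → ℝ} (hφ : IsAveraging μ φ)
    (𝒜 : IsomAction Γ) (ι : S.Space →ₗᵢ[ℝ] 𝒜.H)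
    (hι : ∀ g v, 𝒜.act g (ι v) = ι (Space.affine hf g v)) :
    𝒜.avg μ f (ι (Space.ofAveraging S hf hφ)) =
      ι (Space.ofAveraging S hf (hf.groupConv hφ)) := by
  obtain ⟨i, hi⟩ := exists_subset_pow S.mem_nhds S.generates
    (hf.hasCompactSupport.mul hφ.hasCompactSupport)
  obtain ⟨j, hj⟩ := (hf.isTestFunction S.mem_nhds S.generates).exists_support
  set J := max i j
  have hJ : ∀ t, t ∉ K ^ J → f t = 0 := fun t ht =>
    hj t fun h => ht (mem_pow_of_le S.one_mem (le_max_right _ _) h)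
  have hQ := isCompact_pow S.isCompact J
  obtain ⟨U, hU, hUe, hUi⟩ := exists_groupConv_eq_integral (μ := μ) hf.continuous
    hf.hasCompactSupport hφ.continuous hQ (fun t γ hγ => mul_translate_eq_zero hf.eq_zero
      hφ.eq_zero t γ fun h => hγ (mem_pow_of_le S.one_mem (le_max_left _ _) (hi h)))
  obtain ⟨C, hC⟩ := Space.exists_norm_ofSupported_le (S := S) hf hJ
  let L : SupportedIn (K ^ J) →L[ℝ] 𝒜.H :=
    LinearMap.mkContinuous (ι.toLinearMap ∘ₗ Space.ofSupported hf J) C fun ψ => by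
      rw [LinearMap.comp_apply]
      exact (ι.norm_map _).trans_le (hC ψ)
  have hL : ∀ ψ, L ψ = ι (Space.ofSupported hf J ψ) := fun _ => rfl
  have hcomm := L.integral_comp_comm hU
  have hint : ∀ t, SupportedIn.integral hQ μ (U t) = f t := fun t => by
    rw [SupportedIn.integral_apply]
    simp_rw [hUe]
    rw [integral_const_mul, integral_mul_left_eq_self φ, hφ.integral_eq_one, mul_one]
  -- `U t` has integral `f t`, so `L` subtracts exactly `f t` times `f`.
  have h1 : ∀ t, L (U t) = f t • 𝒜.act t (ι (Space.ofAveraging S hf hφ)) := fun t => by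
    rw [hι, hL, ← map_smul]
    congr 1
    refine Space.ext ?_
    rw [Space.toFun_ofSupported, Space.toFun_smul, Space.toFun_affine, hint]
    funext γ
    simp only [Pi.sub_apply, Pi.smul_apply, smul_eq_mul, hUe, Space.ofAveraging, Space.toFun_mk,
      sub_add_cancel, leftTranslate]
    ring
  have h2 : L (∫ t, U t ∂μ) = ι (Space.ofAveraging S hf (hf.groupConv hφ)) := by
    rw [hL]
    congr 1
    refine Space.ext ?_
    have h3 : SupportedIn.integral hQ μ (∫ t, U t ∂μ) = 1 := by
      rw [← ContinuousLinearMap.integral_comp_comm _ hU]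
      simp_rw [hint]
      exact hf.integral_eq_one
    rw [Space.toFun_ofSupported, h3, one_smul]
    simp_rw [hUi]
    rfl
  unfold IsomAction.avg
  simp_rw [← h1]
  rw [hcomm, h2]

/-- The isometric action which is the limit of a sequence of almost orbits. -/
theorem exists_limit_action (S : AlmostOrbitSequence.{u, v} μ K) (hf : IsAveraging μ f)
    {j : ℕ} (hj : ∀ t, t ∉ K ^ j → f t = 0) {a : ℝ} (ha : ∀ t, |f t| ≤ a) :
    ∃ (𝒜 : IsomAction Γ) (y : 𝒜.H),
      (∀ k ∈ K, dist (𝒜.act k y) y ≤ 3 ^ (1 + j) * μ.real (K ^ (1 + j)) * (a + a)) ∧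
      ∀ (m : ℕ) (k : Γ), Filter.Tendsto (fun n => ‖S.smear n
        (leftTranslate k (groupConvPow μ f (m + 1)) - groupConvPow μ f (m + 1))‖)
        (Filter.hyperfilter ℕ)
        (𝓝 (dist (𝒜.act k ((𝒜.avg μ f)^[m] y)) ((𝒜.avg μ f)^[m] y))) := by
  obtain ⟨𝒜, ι, hι⟩ := IsomAction.exists_ofSeminormed (V := S.Space) (Space.affine hf)
    (fun φ => Space.ext (by
      rw [Space.toFun_affine, leftTranslate_one, add_sub_cancel_right]))
    (fun g h φ => Space.ext (by
      rw [Space.toFun_affine, Space.toFun_affine, Space.toFun_affine, sub_add_cancel,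
        leftTranslate_mul]))
    (Space.dist_affine hf) (Space.continuous_affine hf)
  have hdist : ∀ (k : Γ) {φ : Γ → ℝ} (hφ : IsAveraging μ φ),
      ∃ u : S.Space, u.toFun = leftTranslate k φ - φ ∧
        dist (𝒜.act k (ι (Space.ofAveraging S hf hφ))) (ι (Space.ofAveraging S hf hφ)) = ‖u‖ := by
    intro k φ hφ
    refine ⟨Space.affine hf k (Space.ofAveraging S hf hφ) - Space.ofAveraging S hf hφ, ?_, ?_⟩
    · rw [Space.toFun_sub, Space.toFun_affine, Space.ofAveraging, Space.toFun_mk, sub_add_cancel,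
        sub_sub_sub_cancel_right]
    · rw [hι, ι.dist_map, dist_eq_norm]
  -- The base point is `f - f = 0`, so `m` averagings correspond to the convolution power `m + 1`.
  have hiter : ∀ m, (𝒜.avg μ f)^[m] (ι (Space.ofAveraging S hf hf)) =
      ι (Space.ofAveraging S hf (hf.groupConvPow m)) := by
    intro m
    induction m with
    | zero => rfl
    | succ m ih =>
      rw [Function.iterate_succ_apply', ih]
      exact avg_ofAveraging hf (hf.groupConvPow m) 𝒜 ι hι
  refine ⟨𝒜, ι (Space.ofAveraging S hf hf), fun k hk => ?_, fun m k => ?_⟩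
  · obtain ⟨u, hu, hd⟩ := hdist k hf
    rw [hd]
    refine u.norm_le (fun t ht => ?_) fun t => ?_
    · rw [hu, Pi.sub_apply, leftTranslate_eq_zero (i := 1) (by rwa [pow_one]) hj t ht,
        hj t fun h => ht (mem_pow_of_le S.one_mem (Nat.le_add_left _ _) h), sub_zero]
    · rw [hu, Pi.sub_apply]
      exact (abs_sub _ _).trans (add_le_add (ha _) (ha _))
  · obtain ⟨u, hu, hd⟩ := hdist k (hf.groupConvPow m)
    rw [hiter, hd, ← hu]
    exact u.tendsto_norm

end AlmostOrbitSequence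

/-! ### The uniform estimate for almost orbits, by contradiction. -/

section Uniformity

variable {Γ : Type u} [Group Γ] [TopologicalSpace Γ] [IsTopologicalGroup Γ] [T2Space Γ]
  [MeasurableSpace Γ] [BorelSpace Γ] {μ : Measure Γ} [μ.IsHaarMeasure] {K : Set Γ} {f : Γ → ℝ}

/-- Under property (T), convolution powers almost annihilate differences of translates,
uniformly over all sufficiently good almost orbits. -/
theorem HasPropertyT.exists_norm_integral_translate_sub_le (hT : HasPropertyT Γ)
    (hKc : IsCompact K) (hK : K ∈ 𝓝 (1 : Γ)) (hgen : ∀ γ : Γ, ∃ n : ℕ, γ ∈ K ^ n)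
    (hf : IsAveragingTwo μ K f) {C : ℝ} (hC : 0 < C) :
    ∃ m N : ℕ, ∀ (X : Type v) [NormedAddCommGroup X] [InnerProductSpace ℝ X] [CompleteSpace X]
      (ω : Γ → X), IsAlmostOrbit K N ω → ∀ k ∈ K,
        ‖∫ t, (leftTranslate k (groupConvPow μ f (m + 1)) - groupConvPow μ f (m + 1)) t • ω t ∂μ‖
          ≤ C := by
  have hf1 := hf.toIsAveraging
  obtain ⟨j, hj⟩ := (hf1.isTestFunction hK hgen).exists_support
  obtain ⟨a, ha0, ha⟩ := (hf1.isTestFunction hK hgen).exists_bound hKc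
  -- This bounds the displacement of the base point in every possible limit action, so `m` can be
  -- fixed before any sequence is chosen; the added `1` makes it positive.
  set d : ℝ := 3 ^ (1 + j) * μ.real (K ^ (1 + j)) * (a + a) + 1 with hd
  have hd0 : 0 < d := by positivity
  obtain ⟨m, hm⟩ := hT.exists_iterate_avg_disp_le (μ := μ) hKc hK hgen hf
    (c := C / (4 * d)) (by positivity)
  refine ⟨m, ?_⟩
  by_contra! hcon
  choose X i1 i2 i3 ω hω k hk hlarge using hcon
  let S : AlmostOrbitSequence.{u, v} μ K := ⟨X, ω, hω, hKc, hK, hgen⟩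
  obtain ⟨𝒜, y, hy, hlim⟩ := S.exists_limit_action hf1 hj ha
  set h := groupConvPow μ f (m + 1) with hh
  -- The violating elements `k n` vary with `n`. The limit action is tested at their ultralimit
  -- `k₀`, and uniform continuity of translates of `h` bridges the difference.
  obtain ⟨k₀, hk₀, hkk⟩ := hKc.ultrafilter_le_nhds' ((Filter.hyperfilter ℕ).map k)
    (show ∀ᶠ n in (Filter.hyperfilter ℕ : Filter ℕ), k n ∈ K from
      Filter.Eventually.of_forall hk)
  have hkk' : Filter.Tendsto k (Filter.hyperfilter ℕ) (𝓝 k₀) := hkk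
  have hsmall : dist (𝒜.act k₀ ((𝒜.avg μ f)^[m] y)) ((𝒜.avg μ f)^[m] y) ≤ C / 4 := by
    refine (hm 𝒜 y d hd0 (fun k hk => (hy k hk).trans (by rw [hd]; linarith)) k₀).trans
      (le_of_eq ?_)
    field_simp
  have hav : IsAveraging μ h := hf1.groupConvPow m
  have htest := hav.isTestFunction hK hgen
  obtain ⟨l, hl⟩ := htest.exists_support
  set B : ℝ := 3 ^ (1 + l) * μ.real (K ^ (1 + l)) with hB
  have hB0 : 0 ≤ B := by positivity
  have hη : 0 < C / (4 * (B + 1)) := by positivity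
  have hG : Continuous fun p : Γ × Γ => leftTranslate p.1 h p.2 :=
    htest.continuous.comp (by fun_prop)
  have ev1 : ∀ᶠ n in (Filter.hyperfilter ℕ : Filter ℕ), ‖S.smear n (leftTranslate k₀ h - h)‖ < C / 2 :=
    (hlim m k₀).eventually_lt_const (hsmall.trans_lt (by linarith))
  have ev2 := hkk'.eventually (eventually_forall_mem_compact_abs_sub_lt
    (G := fun g => leftTranslate g h) hG (isCompact_pow hKc (1 + l)) k₀ hη)
  have ev3 : ∀ᶠ n in (Filter.hyperfilter ℕ : Filter ℕ), 1 + l ≤ n :=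
    (Filter.eventually_ge_atTop (1 + l)).filter_mono Nat.hyperfilter_le_atTop
  obtain ⟨n, h1, h2, h3⟩ := (ev1.and (ev2.and ev3)).exists
  have hone : (1 : Γ) ∈ K := mem_of_mem_nhds hK
  have hz : ∀ g ∈ K, ∀ t, t ∉ K ^ (1 + l) → leftTranslate g h t = 0 := fun g hg =>
    leftTranslate_eq_zero (by rwa [pow_one]) hl
  have hint : ∀ g ∈ K, Integrable (fun t => (leftTranslate g h - h) t • S.ω n t) μ := fun g hg =>
    (hω n).integrable_smul hKc hone h3
      (((htest.leftTranslate hgen g).sub hone htest).continuous) fun t ht => by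
        rw [Pi.sub_apply, hz g hg t ht,
          hl t fun h => ht (mem_pow_of_le hone (Nat.le_add_left _ _) h), sub_zero]
  have hdiff : S.smear n (leftTranslate (k n) h - h) - S.smear n (leftTranslate k₀ h - h) =
      S.smear n (leftTranslate (k n) h - leftTranslate k₀ h) := by
    unfold AlmostOrbitSequence.smear
    rw [← integral_sub (hint _ (hk n)) (hint _ hk₀)]
    refine integral_congr_ae (Filter.Eventually.of_forall fun t => ?_)
    simp only [Pi.sub_apply]
    rw [← sub_smul, sub_sub_sub_cancel_right]
  have hle : ‖S.smear n (leftTranslate (k n) h - leftTranslate k₀ h)‖ ≤ B * (C / (4 * (B + 1))) := by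
    refine S.norm_smear_le h3 (fun t ht => ?_) fun t => ?_
    · rw [Pi.sub_apply, hz _ (hk n) t ht, hz _ hk₀ t ht, sub_zero]
    · by_cases ht : t ∈ K ^ (1 + l)
      · exact (h2 t ht).le
      · rw [Pi.sub_apply, hz _ (hk n) t ht, hz _ hk₀ t ht, sub_zero, abs_zero]; exact hη.le
  have hle2 : B * (C / (4 * (B + 1))) ≤ C / 4 := by
    rw [mul_div_assoc', div_le_div_iff₀ (by positivity) (by norm_num)]
    nlinarith
  have hlast : C < ‖S.smear n (leftTranslate (k n) h - h)‖ := hlarge n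
  have htri := norm_sub_norm_le (S.smear n (leftTranslate (k n) h - h))
    (S.smear n (leftTranslate k₀ h - h))
  rw [hdiff] at htri
  linarith

end Uniformity

/-! ### Almost isometries and means. -/

section AlmostAffine

variable {Γ : Type u} [TopologicalSpace Γ] [T2Space Γ] [MeasurableSpace Γ] [BorelSpace Γ]
  {μ : Measure Γ} [IsFiniteMeasureOnCompacts μ]
  {X : Type v} [NormedAddCommGroup X] [InnerProductSpace ℝ X] [CompleteSpace X]

/-- An almost isometry almost commutes with taking means. -/
theorem norm_mean_sub_sq_le {w : Γ → ℝ} {F G : Γ → X} {Q : Set Γ} (hQ : IsCompact Q)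
    (hw : Continuous w) (hw0 : ∀ t, t ∉ Q → w t = 0) (hwn : ∀ t, 0 ≤ w t)
    (hw1 : ∫ t, w t ∂μ = 1) (hF : ContinuousOn F Q) (hG : ContinuousOn G Q) {ε : ℝ} (hε : 0 ≤ ε)
    (hε1 : ε ≤ 1) (hlow : ∀ s ∈ Q, ∀ t ∈ Q, (1 - ε) * ‖F t - F s‖ ≤ ‖G t - G s‖) {p x : X}
    (hup : ∀ t ∈ Q, ‖G t - p‖ ≤ (1 + ε) * ‖F t - ∫ t, w t • F t ∂μ‖) {R : ℝ}
    (hR : ∀ t ∈ Q, ‖F t - x‖ ≤ R) :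
    ‖(∫ t, w t • G t ∂μ) - p‖ ^ 2 ≤ 4 * ε * R ^ 2 := by
  have hwi : Integrable w μ := hw.integrable_of_hasCompactSupport (HasCompactSupport.intro hQ hw0)
  have hFi := integrable_smul_of_continuousOn (μ := μ) hQ hw hw0 hF
  have hGi := integrable_smul_of_continuousOn (μ := μ) hQ hw hw0 hG
  have hFq := integrable_smul_of_continuousOn (μ := μ) hQ hw hw0 (hF.norm.pow 2)
  have hGq := integrable_smul_of_continuousOn (μ := μ) hQ hw hw0 (hG.norm.pow 2)
  have dF := integral_weight_double hwi hFi hFq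
  have dG := integral_weight_double hwi hGi hGq
  have vF := integral_weight_norm_sub_sq hwi hFi hFq (∫ t, w t • F t ∂μ)
  have vG := integral_weight_norm_sub_sq hwi hGi hGq (∫ t, w t • G t ∂μ)
  rw [hw1, real_inner_self_eq_norm_sq] at vF vG
  rw [hw1] at dF dG
  -- The mean square distance of `G` to `p` is at most `(1 + ε) ^ 2 * VF`, while its variance `VG`
  -- is at least `(1 - ε) ^ 2 * VF`; the excess, at most `4 * ε * VF`, bounds the squared distance
  -- from the mean to `p`.
  have eG := integral_weight_norm_sub_sq_eq hwi hw1 hGi hGq p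
  have eF := integral_weight_norm_sub_sq_eq hwi hw1 hFi hFq x
  set VF := ∫ t, w t * ‖F t - ∫ t, w t • F t ∂μ‖ ^ 2 ∂μ with hVF
  set VG := ∫ t, w t * ‖G t - ∫ t, w t • G t ∂μ‖ ^ 2 ∂μ with hVG
  have hmono : (1 - ε) ^ 2 * ∫ s, w s * ∫ t, w t * ‖F t - F s‖ ^ 2 ∂μ ∂μ ≤
      ∫ s, w s * ∫ t, w t * ‖G t - G s‖ ^ 2 ∂μ ∂μ := by
    rw [← integral_const_mul]
    refine integral_mono ((integrable_weight_double hwi hFi hFq).const_mul _)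
      (integrable_weight_double hwi hGi hGq) fun s => ?_
    by_cases hs : s ∈ Q
    · change (1 - ε) ^ 2 * (w s * _) ≤ w s * _
      rw [mul_left_comm]
      refine mul_le_mul_of_nonneg_left ?_ (hwn s)
      rw [← integral_const_mul]
      refine integral_mono ((integrable_weight_norm_sub_sq hwi hFi hFq _).const_mul _)
        (integrable_weight_norm_sub_sq hwi hGi hGq _) fun t => ?_
      by_cases ht : t ∈ Q
      · change (1 - ε) ^ 2 * (w t * _) ≤ w t * _
        rw [mul_left_comm, ← mul_pow]
        exact mul_le_mul_of_nonneg_left (pow_le_pow_left₀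
          (mul_nonneg (by linarith) (norm_nonneg _)) (hlow s hs t ht) 2) (hwn t)
      · simp [hw0 t ht]
    · simp [hw0 s hs]
  have hupint : ∫ t, w t * ‖G t - p‖ ^ 2 ∂μ ≤ (1 + ε) ^ 2 * VF := by
    rw [hVF, ← integral_const_mul]
    refine integral_mono (integrable_weight_norm_sub_sq hwi hGi hGq _)
      ((integrable_weight_norm_sub_sq hwi hFi hFq _).const_mul _) fun t => ?_
    by_cases ht : t ∈ Q
    · change w t * _ ≤ (1 + ε) ^ 2 * (w t * _)
      rw [mul_left_comm, ← mul_pow]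
      exact mul_le_mul_of_nonneg_left (pow_le_pow_left₀ (norm_nonneg _) (hup t ht) 2) (hwn t)
    · simp [hw0 t ht]
  have hVR : VF ≤ R ^ 2 := by
    have h1 : ∫ t, w t * ‖F t - x‖ ^ 2 ∂μ ≤ ∫ t, w t * R ^ 2 ∂μ := by
      refine integral_mono (integrable_weight_norm_sub_sq hwi hFi hFq _) (hwi.mul_const _)
        fun t => ?_
      by_cases ht : t ∈ Q
      · exact mul_le_mul_of_nonneg_left (pow_le_pow_left₀ (norm_nonneg _) (hR t ht) 2) (hwn t)
      · simp [hw0 t ht]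
    rw [integral_mul_const, hw1, one_mul] at h1
    linarith [sq_nonneg ‖(∫ t, w t • F t ∂μ) - x‖]
  rw [dF.trans (show _ = 2 * VF by linarith), dG.trans (show _ = 2 * VG by linarith)] at hmono
  have h2 : (1 - ε) ^ 2 * VF ≤ VG := by linarith
  have h3 : 4 * ε * VF ≤ 4 * ε * R ^ 2 := mul_le_mul_of_nonneg_left hVR (by positivity)
  linarith [show (1 + ε) ^ 2 * VF - (1 - ε) ^ 2 * VF = 4 * ε * VF by ring]

end AlmostAffine

/-! ### Almost actions: orbit bounds and displacement of the average. -/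

section AlmostActions

variable {Γ : Type u} [Group Γ] {K : Set Γ}
  {X : Type v} {r ε δ d : ℝ} {n : ℕ} {x : X} {ρ : Γ → X → X}

theorem IsAlmostAction.dist_le_of_dispK_le [PseudoMetricSpace X]
    (hρ : IsAlmostAction K r n ε δ x ρ) (hd : dispK K ρ x ≤ d) {k : Γ} (hk : k ∈ K) :
    dist (ρ k x) x ≤ d := by
  rw [dist_comm]
  exact (le_csSup hρ.bddAbove (mem_image_of_mem (fun k => dist x (ρ k x)) hk)).trans hd

/-- Each further factor from `K` at most doubles the distance, as `1 + ε ≤ 2`, and adds `d`; hence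
the base `3`. The condition on `r` keeps the orbit in the ball where composition is available. -/
theorem IsAlmostAction.dist_le_of_mem_pow [PseudoMetricSpace X]
    (hρ : IsAlmostAction K r n ε δ x ρ) (h1 : (1 : Γ) ∈ K) (hd : dispK K ρ x ≤ d) (hd0 : 0 < d)
    (hr : 3 ^ n * d < r) (hε : ε ≤ 1) {j : ℕ} (hj : j ≤ n) {γ : Γ} (hγ : γ ∈ K ^ j) :
    dist (ρ γ x) x ≤ 3 ^ j * d := by
  have hx : x ∈ Metric.ball x r := Metric.mem_ball_self (lt_trans (by positivity) hr)
  induction j generalizing γ with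
  | zero =>
    rw [pow_zero, Set.mem_one] at hγ
    rw [hγ, pow_zero, one_mul]
    -- `ρ 1` is not assumed to be the identity, but `1 ∈ K` bounds its displacement of `x`.
    exact hρ.dist_le_of_dispK_le hd h1
  | succ j ih =>
    have hγ' := hγ
    rw [pow_succ'] at hγ
    obtain ⟨k, hk, γ', hγ'', rfl⟩ := Set.mem_mul.1 hγ
    have hjn : j ≤ n := (Nat.le_succ j).trans hj
    have hkn : k ∈ K ^ n := mem_pow_of_le h1 ((Nat.le_add_left 1 j).trans hj) (by rwa [pow_one])
    have hi := ih hjn hγ''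
    have hball : ρ γ' x ∈ Metric.ball x r := by
      rw [Metric.mem_ball]
      refine (hi.trans ?_).trans_lt hr
      gcongr
      norm_num
    rw [← hρ.comp k γ' hkn (mem_pow_of_le h1 hjn hγ'') (mem_pow_of_le h1 hj hγ') x hx hball]
    have h2 := (hρ.almostIsometry k hkn _ hball x hx).2
    have h3 := dist_triangle (ρ k (ρ γ' x)) (ρ k x) x
    have h4 := hρ.dist_le_of_dispK_le hd hk
    have h5 : (1 + ε) * dist (ρ γ' x) x ≤ 2 * (3 ^ j * d) :=
      mul_le_mul (by linarith) hi dist_nonneg (by norm_num)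
    have h6 : d ≤ 3 ^ j * d := le_mul_of_one_le_left hd0.le (one_le_pow₀ (by norm_num))
    rw [pow_succ]
    linarith

theorem IsAlmostAction.mem_ball_of_mem_pow [PseudoMetricSpace X]
    (hρ : IsAlmostAction K r n ε δ x ρ) (h1 : (1 : Γ) ∈ K) (hd : dispK K ρ x ≤ d) (hd0 : 0 < d)
    (hr : 3 ^ n * d < r) (hε : ε ≤ 1) {γ : Γ} (hγ : γ ∈ K ^ n) : ρ γ x ∈ Metric.ball x r :=
  (hρ.dist_le_of_mem_pow h1 hd hd0 hr hε le_rfl hγ).trans_lt hr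

variable [TopologicalSpace Γ] [NormedAddCommGroup X] [InnerProductSpace ℝ X]

/-- The rescaled orbit of the base point of an almost action is an almost orbit. -/
theorem IsAlmostAction.isAlmostOrbit (hρ : IsAlmostAction K r n ε δ x ρ)
    (hcont : ContinuousOn (fun γ => ρ γ x) (K ^ n))
    (h1 : (1 : Γ) ∈ K) (hd : dispK K ρ x ≤ d) (hd0 : 0 < d)
    (hr : 3 ^ n * d < r) (hε0 : 0 ≤ ε) (hε : ε ≤ 1 / (n + 1)) :
    IsAlmostOrbit K n fun γ => d⁻¹ • (ρ γ x - x) := by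
  have hε1 : ε ≤ 1 := hε.trans ((div_le_one (by positivity)).2 (by linarith [n.cast_nonneg (α := ℝ)]))
  have hx : x ∈ Metric.ball x r := Metric.mem_ball_self (lt_trans (by positivity) hr)
  refine ⟨(hcont.sub continuousOn_const).const_smul _, fun j hj γ hγ => ?_,
    fun g hg γ hγ γ' hγ' h2 h3 => ?_⟩
  · rw [norm_smul, norm_inv, Real.norm_eq_abs, abs_of_pos hd0, ← dist_eq_norm,
      inv_mul_le_iff₀ hd0, mul_comm]
    exact hρ.dist_le_of_mem_pow h1 hd hd0 hr hε1 hj hγ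
  · have hb := hρ.mem_ball_of_mem_pow h1 hd hd0 hr hε1 hγ
    have hb' := hρ.mem_ball_of_mem_pow h1 hd hd0 hr hε1 hγ'
    have hiso := hρ.almostIsometry g hg _ hb _ hb'
    rw [hρ.comp g γ hg hγ h2 x hx hb, hρ.comp g γ' hg hγ' h3 x hx hb'] at hiso
    rw [← smul_sub, ← smul_sub, sub_sub_sub_cancel_right, sub_sub_sub_cancel_right, norm_smul,
      norm_smul, mul_pow, mul_pow, ← mul_sub, abs_mul, abs_of_nonneg (sq_nonneg ‖d⁻¹‖),
      mul_left_comm]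
    refine mul_le_mul_of_nonneg_left ?_ (sq_nonneg _)
    rw [← dist_eq_norm, ← dist_eq_norm]
    set A := dist (ρ (g * γ) x) (ρ (g * γ') x)
    set D := dist (ρ γ x) (ρ γ' x)
    have hA : 0 ≤ A := dist_nonneg
    have hD : 0 ≤ D := dist_nonneg
    have hA1 : A ^ 2 ≤ (1 + ε) ^ 2 * D ^ 2 := by
      rw [← mul_pow]; exact pow_le_pow_left₀ hA hiso.2 2
    have hA2 : (1 - ε) ^ 2 * D ^ 2 ≤ A ^ 2 := by
      rw [← mul_pow]; exact pow_le_pow_left₀ (mul_nonneg (by linarith) hD) hiso.1 2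
    -- The constant `3` comes from `(1 + ε) ^ 2 - 1 ≤ 3 * ε`.
    have h4 : 3 * ε * D ^ 2 ≤ 3 / (n + 1) * D ^ 2 := by
      refine mul_le_mul_of_nonneg_right ?_ (sq_nonneg _)
      rw [div_eq_mul_one_div]
      linarith
    have h5 : 0 ≤ D ^ 2 * ε * (1 - ε) := mul_nonneg (by positivity) (by linarith)
    have h6 : 0 ≤ D ^ 2 * ε ^ 2 := by positivity
    have h7 : 0 ≤ D ^ 2 * ε := by positivity
    rw [abs_le]
    constructor <;> nlinarith

variable [IsTopologicalGroup Γ] [T2Space Γ] [MeasurableSpace Γ] [BorelSpace Γ]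
  {μ : Measure Γ} [μ.IsHaarMeasure] [CompleteSpace X] {h : Γ → ℝ} {l : ℕ}

theorem IsAlmostAction.dist_average_le (hρ : IsAlmostAction K r n ε δ x ρ)
    (hcont : ContinuousOn (fun γ => ρ γ x) (K ^ n)) (hKc : IsCompact K)
    (h1 : (1 : Γ) ∈ K) (hd : dispK K ρ x ≤ d) (hd0 : 0 < d)
    (hr : 3 ^ n * d < r) (hε1 : ε ≤ 1) (hh : IsAveraging μ h) (hl : ∀ t, t ∉ K ^ l → h t = 0)
    (hln : l ≤ n) : dist (averageOp μ ρ h x) x ≤ 3 ^ l * d := by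
  have hint : Integrable (fun γ => h γ • ρ γ x) μ :=
    integrable_smul_of_continuousOn (isCompact_pow hKc l) hh.continuous hl
      (hcont.mono (Set.pow_subset_pow_right h1 hln))
  have e : averageOp μ ρ h x - x = ∫ γ, h γ • (ρ γ x - x) ∂μ := by
    simp_rw [smul_sub]
    rw [integral_sub hint (hh.integrable.smul_const x), integral_smul_const, hh.integral_eq_one,
      one_smul]
    rfl
  rw [dist_eq_norm, e]
  have h2 := norm_integral_le_of_norm_le (f := fun γ => h γ • (ρ γ x - x))
    (hh.integrable.mul_const (3 ^ l * d)) (Filter.Eventually.of_forall fun γ => by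
      rw [norm_smul, Real.norm_eq_abs, abs_of_nonneg (hh.nonneg γ)]
      by_cases hγ : γ ∈ K ^ l
      · rw [← dist_eq_norm]
        exact mul_le_mul_of_nonneg_left (hρ.dist_le_of_mem_pow h1 hd hd0 hr hε1 hln hγ)
          (hh.nonneg γ)
      · simp [hl γ hγ])
  rwa [integral_mul_const, hh.integral_eq_one, one_mul] at h2

/-- The intermediate point is the `h`-mean of `ρ (k * t) x`. It is near `ρ k` of the average because
`ρ k` almost commutes with means, and near the average itself by `hmain`; each error is at most `c *
d`. -/
theorem IsAlmostAction.dist_average_act_le (hρ : IsAlmostAction K r n ε δ x ρ)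
    (hcont : ContinuousOn (fun γ => ρ γ x) (K ^ n)) (hKc : IsCompact K)
    (h1 : (1 : Γ) ∈ K) (hd : dispK K ρ x ≤ d) (hd0 : 0 < d)
    (hr : 3 ^ n * d < r) (hε0 : 0 ≤ ε) (hε1 : ε ≤ 1) (hh : IsAveraging μ h)
    (hl : ∀ t, t ∉ K ^ l → h t = 0) (hln : 1 + l ≤ n) {c : ℝ} (hc : 0 ≤ c)
    (hεc : 4 * ε * (3 ^ l) ^ 2 ≤ c ^ 2) {k : Γ} (hk : k ∈ K)
    (hmain : ‖∫ t, (leftTranslate k h - h) t • (d⁻¹ • (ρ t x - x)) ∂μ‖ ≤ c) :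
    dist (averageOp μ ρ h x) (ρ k (averageOp μ ρ h x)) ≤ (c + c) * d := by
  have hln' : l ≤ n := (Nat.le_add_left l 1).trans hln
  have hx : x ∈ Metric.ball x r := Metric.mem_ball_self (lt_trans (by positivity) hr)
  have hkn : k ∈ K ^ n := mem_pow_of_le h1 ((Nat.le_add_right 1 l).trans hln) (by rwa [pow_one])
  set y := averageOp μ ρ h x with hy
  have hyb : y ∈ Metric.ball x r := by
    refine (hρ.dist_average_le hcont hKc h1 hd hd0 hr hε1 hh hl hln').trans_lt (lt_of_le_of_lt ?_ hr)
    gcongr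
    norm_num
  have hsub : ∀ t ∈ K ^ l, t ∈ K ^ n := fun t ht => mem_pow_of_le h1 hln' ht
  have hmul : ∀ t ∈ K ^ l, k * t ∈ K ^ (1 + l) := fun t ht =>
    mul_mem_pow_add (by rwa [pow_one]) ht
  have hball : ∀ t ∈ K ^ l, ρ t x ∈ Metric.ball x r := fun t ht =>
    hρ.mem_ball_of_mem_pow h1 hd hd0 hr hε1 (hsub t ht)
  have hcomp : ∀ t ∈ K ^ l, ρ (k * t) x = ρ k (ρ t x) := fun t ht =>
    (hρ.comp k t hkn (hsub t ht) (mem_pow_of_le h1 hln (hmul t ht)) x hx (hball t ht)).symm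
  have hcontk : ContinuousOn (fun t => ρ (k * t) x) (K ^ l) :=
    hcont.comp (continuous_const_mul k).continuousOn fun t ht => mem_pow_of_le h1 hln (hmul t ht)
  have hAff : ‖(∫ t, h t • ρ (k * t) x ∂μ) - ρ k y‖ ^ 2 ≤ 4 * ε * (3 ^ l * d) ^ 2 := by
    refine norm_mean_sub_sq_le (F := fun t => ρ t x) (x := x) (isCompact_pow hKc l) hh.continuous
      hl hh.nonneg hh.integral_eq_one (hcont.mono hsub) hcontk hε0 hε1 ?_ ?_ ?_
    · intro s hs t ht
      rw [hcomp t ht, hcomp s hs, ← dist_eq_norm, ← dist_eq_norm]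
      exact (hρ.almostIsometry k hkn _ (hball t ht) _ (hball s hs)).1
    · intro t ht
      rw [hcomp t ht, ← dist_eq_norm, ← dist_eq_norm]
      exact (hρ.almostIsometry k hkn _ (hball t ht) _ hyb).2
    · intro t ht
      rw [← dist_eq_norm]
      exact hρ.dist_le_of_mem_pow h1 hd hd0 hr hε1 hln' ht
  have hfirst : ‖(∫ t, h t • ρ (k * t) x ∂μ) - ρ k y‖ ≤ c * d := by
    refine abs_le_of_sq_le_sq' (hAff.trans ?_) (by positivity) |>.2
    rw [mul_pow, mul_pow, ← mul_assoc]
    exact mul_le_mul_of_nonneg_right hεc (sq_nonneg _)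
  have htr : ∫ t, h t • ρ (k * t) x ∂μ = ∫ t, leftTranslate k h t • ρ t x ∂μ := by
    rw [← integral_mul_left_eq_self (fun t => leftTranslate k h t • ρ t x) k]
    simp [leftTranslate]
  have hint1 : Integrable (fun t => leftTranslate k h t • ρ t x) μ :=
    integrable_smul_of_continuousOn (isCompact_pow hKc (1 + l))
      (hh.continuous.comp (continuous_const_mul _))
      (leftTranslate_eq_zero (by rwa [pow_one]) hl)
      (hcont.mono (Set.pow_subset_pow_right h1 hln))
  have hint2 : Integrable (fun t => h t • ρ t x) μ :=
    integrable_smul_of_continuousOn (isCompact_pow hKc l) hh.continuous hl (hcont.mono hsub)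
  have hint3 : Integrable (leftTranslate k h) μ := hh.integrable.comp_mul_left k⁻¹
  have hzero : ∫ t, (leftTranslate k h t - h t) ∂μ = 0 := by
    rw [integral_sub hint3 hh.integrable]
    unfold leftTranslate
    rw [integral_mul_left_eq_self h, sub_self]
  have hsecond : (∫ t, h t • ρ (k * t) x ∂μ) - y =
      d • ∫ t, (leftTranslate k h - h) t • (d⁻¹ • (ρ t x - x)) ∂μ := by
    have e1 : ∀ t, (leftTranslate k h - h) t • (d⁻¹ • (ρ t x - x)) =
        d⁻¹ • ((leftTranslate k h t • ρ t x - h t • ρ t x) -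
          (leftTranslate k h t - h t) • x) := fun t => by
      rw [smul_comm, ← sub_smul, smul_sub]
      rfl
    simp_rw [e1]
    have e2 : ∫ t, ((leftTranslate k h t • ρ t x - h t • ρ t x) -
        (leftTranslate k h t - h t) • x) ∂μ = ∫ t, (leftTranslate k h t • ρ t x - h t • ρ t x) ∂μ -
        ∫ t, (leftTranslate k h t - h t) • x ∂μ :=
      integral_sub (hint1.sub hint2) ((hint3.sub hh.integrable).smul_const x)
    rw [integral_smul, smul_inv_smul₀ hd0.ne', e2, integral_smul_const, hzero, zero_smul, sub_zero,
      integral_sub hint1 hint2, htr]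
    rfl
  have hsecond' : ‖(∫ t, h t • ρ (k * t) x ∂μ) - y‖ ≤ c * d := by
    rw [hsecond, norm_smul, Real.norm_eq_abs, abs_of_pos hd0, mul_comm]
    exact mul_le_mul_of_nonneg_right hmain hd0.le
  rw [← dist_eq_norm] at hfirst hsecond'
  refine (dist_triangle_left _ _ (∫ t, h t • ρ (k * t) x ∂μ)).trans ?_
  linarith

end AlmostActions

/-! ### Choice of constants and conclusion. -/

theorem mainTheorem4
    {Γ : Type u} [Group Γ] [TopologicalSpace Γ] [IsTopologicalGroup Γ] [T2Space Γ]
    [LocallyCompactSpace Γ] [SigmaCompactSpace Γ] [MeasurableSpace Γ] [BorelSpace Γ]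
    (μ : Measure Γ) [μ.IsHaarMeasure]
    (K : Set Γ) (hK_compact : IsCompact K) (hK_nhds : K ∈ 𝓝 (1 : Γ))
    (hK_gen : ∀ γ : Γ, ∃ n : ℕ, γ ∈ K ^ n)
    (hT : HasPropertyT Γ)
    (f : Γ → ℝ) (hf : IsAveragingTwo μ K f)
    (C : ℝ) (hC_pos : 0 < C) (hC_lt : C < 1) :
    ∃ ε : ℝ, 0 < ε ∧ ∃ m s M : ℕ, 0 < m ∧ 0 < s ∧ 0 < M ∧
      tsupport (groupConvPow μ f m) ⊆ K ^ s ∧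
      ∀ δ₀ : ℝ, 0 < δ₀ → ∃ r : ℝ, 0 < r ∧
        ∀ (X : Type v) [NormedAddCommGroup X] [InnerProductSpace ℝ X] [CompleteSpace X]
          (δ : ℝ), 0 < δ → δ ≤ δ₀ →
          ∀ (x : X) (ρ : Γ → X → X),
            IsAlmostAction K r s ε δ x ρ →
            ContinuousOn (fun p : Γ × X => ρ p.1 p.2) ((K ^ s) ×ˢ Metric.ball x r) →
            Integrable (fun γ => groupConvPow μ f m γ • ρ γ x) μ ∧
            averageOp μ ρ (groupConvPow μ f m) x ∈ Metric.ball x r ∧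
            dist x (averageOp μ ρ (groupConvPow μ f m) x) ≤ M * dispK K ρ x ∧
            dispK K ρ (averageOp μ ρ (groupConvPow μ f m) x) ≤ C * dispK K ρ x := by
  have h1 : (1 : Γ) ∈ K := mem_of_mem_nhds hK_nhds
  obtain ⟨m, N, hN⟩ := hT.exists_norm_integral_translate_sub_le.{u, v} hK_compact hK_nhds hK_gen hf
    (half_pos hC_pos)
  have hh : IsAveraging μ (groupConvPow μ f (m + 1)) := hf.toIsAveraging.groupConvPow m
  obtain ⟨l, hl⟩ := exists_subset_pow hK_nhds hK_gen hh.hasCompactSupport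
  have hl0 : ∀ t, t ∉ K ^ l → groupConvPow μ f (m + 1) t = 0 := fun t ht =>
    hh.eq_zero t fun h => ht (hl h)
  obtain ⟨P, hP⟩ := exists_nat_gt (4 * (3 ^ l) ^ 2 / (C / 2) ^ 2)
  -- One `n` plays three roles: almost orbits are good enough for `N`, `K ^ n` contains `K` times
  -- the support of `h`, and `ε = 1 / (n + 1)` makes the error of commuting with means at most `C /
  -- 2`.
  set n : ℕ := max (max N (1 + l)) P with hn
  have hNn : N ≤ n := (le_max_left _ _).trans (le_max_left _ _)
  have hln : 1 + l ≤ n := (le_max_right _ _).trans (le_max_left _ _)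
  have hPn : (P : ℝ) ≤ n := by exact_mod_cast le_max_right _ _
  have hn0 : (0 : ℝ) < (n : ℝ) + 1 := by positivity
  have hε1 : 1 / ((n : ℝ) + 1) ≤ 1 := (div_le_one hn0).2 (by linarith [n.cast_nonneg (α := ℝ)])
  have hεc : 4 * (1 / ((n : ℝ) + 1)) * (3 ^ l) ^ 2 ≤ (C / 2) ^ 2 := by
    rw [div_lt_iff₀ (by positivity)] at hP
    rw [mul_one_div, div_mul_eq_mul_div, div_le_iff₀ hn0]
    nlinarith [sq_nonneg (C / 2)]
  refine ⟨1 / ((n : ℝ) + 1), by positivity, m + 1, n, 3 ^ n, Nat.succ_pos m,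
    lt_of_lt_of_le (by omega) hln, by positivity,
    hl.trans (Set.pow_subset_pow_right h1 (by omega)), fun δ₀ hδ₀ => ⟨3 ^ n * δ₀, by positivity, ?_⟩⟩
  intro X _ _ _ δ hδ hδδ₀ x ρ hρ hcont
  have hx : x ∈ Metric.ball x (3 ^ n * δ₀) := Metric.mem_ball_self (by positivity)
  have hcontx : ContinuousOn (fun γ => ρ γ x) (K ^ n) :=
    hcont.comp (f := fun γ : Γ => (γ, x)) (by fun_prop) fun γ hγ => ⟨hγ, hx⟩
  have hdisp0 : 0 ≤ dispK K ρ x :=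
    dist_nonneg.trans (le_csSup hρ.bddAbove (mem_image_of_mem (fun k => dist x (ρ k x)) h1))
  -- Estimates are made with `d` strictly between the displacement and `δ`, then `d` tends to the
  -- displacement. Thus rescaling by `d⁻¹` is legitimate even when the displacement is zero.
  have hrd : ∀ d, d < δ → 3 ^ n * d < 3 ^ n * δ₀ := fun d hd =>
    mul_lt_mul_of_pos_left (hd.trans_le hδδ₀) (by positivity)
  have hdist : ∀ d, dispK K ρ x < d → d < δ →
      dist (averageOp μ ρ (groupConvPow μ f (m + 1)) x) x ≤ 3 ^ l * d := fun d hd hdδ =>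
    hρ.dist_average_le hcontx hK_compact h1 hd.le (hdisp0.trans_lt hd) (hrd d hdδ) hε1 hh hl0
      (by omega)
  have hpow : (3 : ℝ) ^ l ≤ 3 ^ n := pow_le_pow_right₀ (by norm_num) (by omega)
  refine ⟨integrable_smul_of_continuousOn (isCompact_pow hK_compact l) hh.continuous hl0
    (hcontx.mono (Set.pow_subset_pow_right h1 (by omega))), ?_, ?_, ?_⟩
  · obtain ⟨d, hd, hdδ⟩ := exists_between hρ.disp_lt
    refine (hdist d hd hdδ).trans_lt (lt_of_le_of_lt ?_ (hrd d hdδ))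
    exact mul_le_mul_of_nonneg_right hpow (hdisp0.trans hd.le)
  · have h2 : dist x (averageOp μ ρ (groupConvPow μ f (m + 1)) x) ≤ 3 ^ l * dispK K ρ x := by
      refine ge_of_tendsto (f := fun d => 3 ^ l * d) (x := 𝓝[>] (dispK K ρ x))
        ((continuous_const_mul _).continuousWithinAt.tendsto) ?_
      filter_upwards [Ioo_mem_nhdsGT hρ.disp_lt] with d hd
      rw [dist_comm]
      exact hdist d hd.1 hd.2
    refine h2.trans ?_
    push_cast
    exact mul_le_mul_of_nonneg_right hpow hdisp0
  · refine csSup_le (Set.Nonempty.image _ ⟨1, h1⟩) ?_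
    rintro _ ⟨k, hk, rfl⟩
    refine ge_of_tendsto (f := fun d => C * d) (x := 𝓝[>] (dispK K ρ x))
        ((continuous_const_mul _).continuousWithinAt.tendsto) ?_
    filter_upwards [Ioo_mem_nhdsGT hρ.disp_lt] with d hd
    have hd0 : 0 < d := hdisp0.trans_lt hd.1
    have horb := hρ.isAlmostOrbit hcontx h1 hd.1.le hd0 (hrd d hd.2) (by positivity) le_rfl
    have h3 := hρ.dist_average_act_le hcontx hK_compact h1 hd.1.le hd0 (hrd d hd.2) (by positivity)
      hε1 hh hl0 hln (half_pos hC_pos).le hεc hk (hN X _ (horb.mono h1 hNn) k hk)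
    rwa [add_halves] at h3
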